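/- Let $\mathcal H$ be a complex Hilbert space. Let $\mathcal C_<$ be the set of bounded operators $C$ on $\mathcal H$ such that $|C|^p$ is of trace class for some $p\in(0,1)$, let $\mathrm{int}\,\Sigma$ be the set of faithful density operators (positive trace class operators of trace one with trivial kernel), and put $\mathcal M=\mathcal C_<\cap \mathrm{int}\,\Sigma$. Let $\rho_0\in\mathcal M$ and let $c\in\mathbb R$ be such that $H_0:=-\log\rho_0+cI\ge I$. Write $R_0=H_0^{-1}$, and let $q_0(\varphi,\psi)=\langle H_0^{1/2}\varphi,H_0^{1/2}\psi\rangle$, with domain $\mathrm{Dom}\,q_0=\mathrm{Dom}\,H_0^{1/2}$, be the form of $H_0$. For a Hermitian sesquilinear form $V$ on $\mathrm{Dom}\,q_0$ put $$\|V\|_0=\|R_0^{1/2}VR_0^{1/2}\|_\infty=\sup\{|V(R_0^{1/2}\varphi,R_0^{1/2}\psi)|:\|\varphi\|,\|\psi\|\le1\}\in[0,\infty].$$ Then there is $\varepsilon>0$ such that, for every Hermitian form $V$ on $\mathrm{Dom}\,q_0$ with $\|V\|_0<\varepsilon$, the operator $H_V=H_0+V$ associated with the form $q_V=q_0+V$ is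 self-adjoint, and: 1. $H_V$ has purely discrete spectrum (its spectrum consists of isolated eigenvalues of finite multiplicity); 2. $e^{-\beta H_V}$ is of trace class for some $\beta$ with $0<\beta<1$; 3. the state $\rho_V=Z_V^{-1}e^{-H_V}$, where $Z_V=\mathrm{Tr}\,e^{-H_V}$, belongs to $\mathcal M$. -/

import Mathlib

open scoped InnerProductSpace ENNReal ComplexConjugate

namespace QuantumInfo

variable {E : Type*} [NormedAddCommGroup E] [InnerProductSpace ℂ E] [CompleteSpace E]

/-! ### Trace class operators, density operators and the class `M` -/

/-- `T` is of trace class: `∑ ⟨eᵢ, |T| eᵢ⟩ < ∞` for every orthonormal basis of `E`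
(index sets may be taken inside `E`). -/
def IsTraceClass (T : E →L[ℂ] E) : Prop :=
  ∀ (s : Set E) (b : HilbertBasis s ℂ E),
    Summable fun i => RCLike.re ⟪b i, CFC.abs T (b i)⟫_ℂ

/-- The trace `∑ ⟨eᵢ, T eᵢ⟩`, computed in some orthonormal basis (for a trace class `T` the
value does not depend on the basis). -/
noncomputable def opTrace (T : E →L[ℂ] E) : ℂ :=
  ∑' i, ⟪(exists_hilbertBasis ℂ E).choose_spec.choose i,
    T ((exists_hilbertBasis ℂ E).choose_spec.choose i)⟫_ℂ

/-- Density operators: positive, of trace class, with trace one. -/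
def IsDensityOperator (ρ : E →L[ℂ] E) : Prop :=
  ρ.IsPositive ∧ IsTraceClass ρ ∧ opTrace ρ = 1

/-- The class `C_p`: operators `C` such that `|C|^p` is of trace class. -/
def classC (E : Type*) [NormedAddCommGroup E] [InnerProductSpace ℂ E] [CompleteSpace E]
    (p : ℝ) : Set (E →L[ℂ] E) :=
  {C | IsTraceClass ((CFC.abs C) ^ p)}

/-- `C_<`, the union of the classes `C_p` over `0 < p < 1`. -/
def classCLt (E : Type*) [NormedAddCommGroup E] [InnerProductSpace ℂ E] [CompleteSpace E] :
    Set (E →L[ℂ] E) :=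
  ⋃ p ∈ Set.Ioo (0 : ℝ) 1, classC E p

/-- The faithful states `int Σ`: density operators with trivial kernel. -/
def faithfulStates (E : Type*) [NormedAddCommGroup E] [InnerProductSpace ℂ E]
    [CompleteSpace E] : Set (E →L[ℂ] E) :=
  {ρ | IsDensityOperator ρ ∧ Function.Injective ρ}

/-- The underlying set `M = C_< ∩ int Σ` of the quantum information manifold. -/
def manifoldM (E : Type*) [NormedAddCommGroup E] [InnerProductSpace ℂ E] [CompleteSpace E] :
    Set (E →L[ℂ] E) :=
  classCLt E ∩ faithfulStates E

/-! ### Unbounded operators: spectrum and functional calculus -/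

/-- A bounded operator, seen as an everywhere defined (partial) operator. -/
def ofBounded (T : E →L[ℂ] E) : E →ₗ.[ℂ] E := (T : E →ₗ[ℂ] E).toPMap ⊤

/-- The eigenspace `{x ∈ Dom A | A x = z x}`. -/
def eigenspace (A : E →ₗ.[ℂ] E) (z : ℂ) : Submodule ℂ E :=
  (LinearMap.ker (A.toFun - z • A.domain.subtype)).map A.domain.subtype

/-- The orthogonal projection onto the eigenspace of the real number `x` (the eigenspaces of a
self-adjoint operator are closed). -/
noncomputable def eigenProj (A : E →ₗ.[ℂ] E) (x : ℝ) : E →L[ℂ] E :=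
  (eigenspace A (x : ℂ)).topologicalClosure.starProjection

/-- The functional calculus `f(A) = ∑ₓ f(x) Pₓ` (sum over the eigenvalues `x` of `A`, with `Pₓ`
the eigenprojections) of a self-adjoint operator `A` with a complete set of eigenvectors. Its
domain is the set of those `ψ` for which `∑ₓ f(x) Pₓ ψ` converges, that is,
`∑ₓ |f(x)|² ‖Pₓ ψ‖² < ∞`. -/
noncomputable def funCalc (A : E →ₗ.[ℂ] E) (f : ℝ → ℝ) : E →ₗ.[ℂ] E where
  domain :=
    { carrier := {ψ | Summable fun x : ℝ => (f x : ℂ) • eigenProj A x ψ}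
      zero_mem' := by simp
      add_mem' := fun {a b} ha hb => by
        simpa only [Set.mem_ofPred_eq, map_add, smul_add] using Summable.add ha hb
      smul_mem' := fun z a ha => by
        simpa only [Set.mem_ofPred_eq, map_smul, smul_comm _ z] using Summable.const_smul z ha }
  toFun :=
    { toFun := fun ψ => ∑' x : ℝ, (f x : ℂ) • eigenProj A x (ψ : E)
      map_add' := fun a b => by
        simpa only [Submodule.coe_add, map_add, smul_add] using
          Summable.tsum_add a.property b.property
      map_smul' := fun z a => by
        simpa only [Submodule.coe_smul, map_smul, smul_comm _ z, RingHom.id_apply] using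
          Summable.tsum_const_smul z a.property }

/-- The resolvent set: those `z` for which `A - z` has an everywhere defined bounded inverse. -/
def opResolventSet (A : E →ₗ.[ℂ] E) : Set ℂ :=
  {z | ∃ R : E →L[ℂ] E,
    (∀ y : E, ∃ h : R y ∈ A.domain, A ⟨R y, h⟩ - z • R y = y) ∧
    ∀ x : A.domain, R (A x - z • (x : E)) = x}

/-- The spectrum of an unbounded operator. -/
def opSpectrum (A : E →ₗ.[ℂ] E) : Set ℂ := (opResolventSet A)ᶜ

/-- Purely discrete spectrum: the spectrum consists of isolated eigenvalues of finite
multiplicity. -/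
def HasPurelyDiscreteSpectrum (A : E →ₗ.[ℂ] E) : Prop :=
  ∀ z ∈ opSpectrum A,
    (∃ δ > 0, ∀ w ∈ opSpectrum A, dist w z < δ → w = z) ∧
    eigenspace A z ≠ ⊥ ∧ FiniteDimensional ℂ (eigenspace A z)

/-- An unbounded operator is of trace class if it is everywhere defined and bounded, and is of
trace class as a bounded operator. -/
def IsTraceClassOp (A : E →ₗ.[ℂ] E) : Prop :=
  ∃ T : E →L[ℂ] E, ofBounded T = A ∧ IsTraceClass T

open Classical in
/-- The bounded operator `T` with `T = A`, if `A` is everywhere defined and bounded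
(and `0` otherwise). -/
noncomputable def toBounded (A : E →ₗ.[ℂ] E) : E →L[ℂ] E :=
  if h : ∃ T : E →L[ℂ] E, ofBounded T = A then h.choose else 0

/-- The operator `exp(-tH)`. -/
noncomputable def expNeg (t : ℝ) (H : E →ₗ.[ℂ] E) : E →ₗ.[ℂ] E :=
  funCalc H fun x => Real.exp (-(t * x))

/-- The state `Z⁻¹ exp(-H)`, `Z = Tr exp(-H)`. -/
noncomputable def gibbsState (H : E →ₗ.[ℂ] E) : E →L[ℂ] E :=
  (opTrace (toBounded (expNeg 1 H)))⁻¹ • toBounded (expNeg 1 H)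

/-! ### The Hamiltonian of a state and its form perturbations -/

/-- The Hamiltonian `H₀ = -log ρ₀ + c I` of a faithful state `ρ₀`. -/
noncomputable def hamiltonian (ρ : E →L[ℂ] E) (c : ℝ) : E →ₗ.[ℂ] E :=
  funCalc (ofBounded ρ) fun x => -Real.log x + c

/-- `H ≥ I`. -/
def GeOne (H : E →ₗ.[ℂ] E) : Prop :=
  ∀ ψ : H.domain, ‖(ψ : E)‖ ^ 2 ≤ RCLike.re ⟪(ψ : E), H ψ⟫_ℂ

/-- `H^{1/2}`. -/
noncomputable def sqrtOp (H : E →ₗ.[ℂ] E) : E →ₗ.[ℂ] E :=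
  funCalc H fun x => Real.sqrt x

/-- The square root `R^{1/2} = H^{-1/2}` of the resolvent `R = H⁻¹`. -/
noncomputable def sqrtResolvent (H : E →ₗ.[ℂ] E) : E →ₗ.[ℂ] E :=
  funCalc H fun x => (Real.sqrt x)⁻¹

/-- The form domain `Dom q = Dom H^{1/2}`. -/
noncomputable def formDomain (H : E →ₗ.[ℂ] E) : Submodule ℂ E := (sqrtOp H).domain

/-- The form `q(φ, ψ) = ⟨H^{1/2} φ, H^{1/2} ψ⟩` of `H`. -/
noncomputable def hamForm (H : E →ₗ.[ℂ] E) :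
    formDomain H →ₗ⋆[ℂ] formDomain H →ₗ[ℂ] ℂ :=
  LinearMap.mk₂'ₛₗ (starRingEnd ℂ) (RingHom.id ℂ)
    (fun φ ψ => ⟪sqrtOp H φ, sqrtOp H ψ⟫_ℂ)
    (fun a b ψ => by rw [← inner_add_left]; exact congrArg (⟪·, _⟫_ℂ) (LinearPMap.map_add _ a b))
    (fun z a ψ => by
      rw [smul_eq_mul, ← inner_smul_left]; exact congrArg (⟪·, _⟫_ℂ) (LinearPMap.map_smul _ z a))
    (fun φ a b => by rw [← inner_add_right]; exact congrArg (⟪_, ·⟫_ℂ) (LinearPMap.map_add _ a b))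
    (fun z φ a => by
      rw [RingHom.id_apply, smul_eq_mul, ← inner_smul_right]
      exact congrArg (⟪_, ·⟫_ℂ) (LinearPMap.map_smul _ z a))

/-- The norm `‖V‖₀ = ‖R^{1/2} V R^{1/2}‖ ∈ [0, ∞]` of a form `V` on `Dom q`: the supremum of
`|V(R^{1/2} φ, R^{1/2} ψ)|` over `‖φ‖, ‖ψ‖ ≤ 1`. -/
noncomputable def formNorm (H : E →ₗ.[ℂ] E)
    (V : formDomain H →ₗ⋆[ℂ] formDomain H →ₗ[ℂ] ℂ) : ℝ≥0∞ :=
  ⨆ (φ : (sqrtResolvent H).domain) (ψ : (sqrtResolvent H).domain)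
    (_ : ‖(φ : E)‖ ≤ 1) (_ : ‖(ψ : E)‖ ≤ 1)
    (u : formDomain H) (v : formDomain H)
    (_ : (u : E) = sqrtResolvent H φ) (_ : (v : E) = sqrtResolvent H ψ), ‖V u v‖ₑ

/-- The operator associated with a form `q` on `Q`: `x ∈ Q` lies in its domain, with value `y`,
if and only if `q(v, x) = ⟨v, y⟩` for all `v ∈ Q`. -/
noncomputable def formOperator {Q : Submodule ℂ E} (q : Q →ₗ⋆[ℂ] Q →ₗ[ℂ] ℂ) :
    E →ₗ.[ℂ] E :=
  Submodule.toLinearPMap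
    { carrier := {z : E × E | ∃ h : z.1 ∈ Q, ∀ v : Q, q v ⟨z.1, h⟩ = ⟪(v : E), z.2⟫_ℂ}
      zero_mem' := ⟨Q.zero_mem, fun v => by
        rw [Prod.snd_zero, inner_zero_right]; exact map_zero (q v)⟩
      add_mem' := by
        rintro a b ⟨ha, ha'⟩ ⟨hb, hb'⟩
        refine ⟨Q.add_mem ha hb, fun v => ?_⟩
        have := map_add (q v) ⟨a.1, ha⟩ ⟨b.1, hb⟩
        rw [ha', hb', ← inner_add_right] at this
        exact this
      smul_mem' := by
        rintro t a ⟨ha, ha'⟩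
        refine ⟨Q.smul_mem t ha, fun v => ?_⟩
        have := map_smul (q v) t ⟨a.1, ha⟩
        rw [ha', smul_eq_mul, ← inner_smul_right] at this
        exact this }

/-- `H_V = H + V`, the operator of the form `q_V = q + V`. -/
noncomputable def perturbed (H : E →ₗ.[ℂ] E)
    (V : formDomain H →ₗ⋆[ℂ] formDomain H →ₗ[ℂ] ℂ) : E →ₗ.[ℂ] E :=
  formOperator (hamForm H + V)

end QuantumInfo

open QuantumInfo

/-! Everything is reduced to coordinates. A trace class state is compact, so `ρ₀` is diagonal in
some Hilbert basis `b` with eigenvalues `d i`. Then `H₀` is multiplication by `h i = -log (d i) + c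
≥ 1`, and `ρ₀ ∈ C_<` says that `∑ exp (-(p * h i))` converges for some `p < 1`.

Put `S = R₀^{1/2}`, which maps `E` onto the form domain. If `‖V‖₀ < a < 1`, then `V (S x) (S y) =
⟪x, B y⟫` with `B` self-adjoint and `‖B‖ ≤ a`, so `q_V (S x) (S y) = ⟪x, K y⟫` with `K = 1 + B`
invertible. Hence `H_V` is the inverse of `S K⁻¹ S` (`formOperator_isDiag`). That operator is
compact, self-adjoint and strictly positive, so `H_V` is diagonal in a basis `f` with eigenvalues `μ
n > 0`.

The trace estimate rests on `q_V ≥ (1 - a) q₀`, which gives `μ n ≥ (1 - a) q₀(f n, f n)`. Jensen's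
inequality (`exp_neg_mul_le_tsum`) bounds `exp (-p q₀(f n, f n))` by the average of `exp (-(p * h
i))` with weights `‖⟪b i, f n⟫‖²`. Summing over `n`, Parseval returns `∑ exp (-(p * h i))`. So `exp
(-β H_V)` is of trace class once `p ≤ β (1 - a)`, and `β < 1` is possible when `a < 1 - p`.
Compactness, discreteness and membership in `M` are then read off from the eigenvalues. -/

namespace QuantumInfo

variable {E : Type*} [NormedAddCommGroup E] [InnerProductSpace ℂ E]
variable {ι : Type*}

set_option linter.unusedSectionVars false

/-! ### Coordinates in a Hilbert basis -/

lemma hilbertBasis_ext (b : HilbertBasis ι ℂ E) {x y : E}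
    (h : ∀ i, ⟪b i, x⟫_ℂ = ⟪b i, y⟫_ℂ) : x = y := by
  apply b.repr.injective
  ext i
  simpa [b.repr_apply_apply] using h i

lemma hasSum_norm_sq_inner (b : HilbertBasis ι ℂ E) (x : E) :
    HasSum (fun i => ‖⟪b i, x⟫_ℂ‖ ^ 2) (‖x‖ ^ 2) := by
  have h := (b.hasSum_inner_mul_inner x x).mapL Complex.reCLM
  convert h using 1
  · ext i
    rw [← inner_conj_symm x (b i)]
    simp only [Complex.reCLM_apply]
    rw [← Complex.normSq_eq_conj_mul_self, Complex.ofReal_re, Complex.normSq_eq_norm_sq]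
  · exact (inner_self_eq_norm_sq (𝕜 := ℂ) x).symm

lemma sum_norm_sq_inner_le (b : HilbertBasis ι ℂ E) (G : Finset ι) (x : E) :
    ∑ i ∈ G, ‖⟪b i, x⟫_ℂ‖ ^ 2 ≤ ‖x‖ ^ 2 :=
  sum_le_hasSum G (fun _ _ => sq_nonneg _) (hasSum_norm_sq_inner b x)

lemma exists_inner_eq (b : HilbertBasis ι ℂ E) (c : ι → ℂ) (hc : Summable fun i => ‖c i‖ ^ 2) :
    ∃ x, ∀ i, ⟪b i, x⟫_ℂ = c i := by
  have hm : Memℓp c 2 := memℓp_gen (by simpa using hc)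
  refine ⟨b.repr.symm ⟨c, hm⟩, fun i => ?_⟩
  rw [← b.repr_apply_apply, LinearIsometryEquiv.apply_symm_apply]

lemma inner_hilbertBasis_self (b : HilbertBasis ι ℂ E) (i : ι) : ⟪b i, b i⟫_ℂ = 1 := by
  rw [inner_self_eq_norm_sq_to_K, b.orthonormal.1]; simp

lemma inner_hilbertBasis_ne (b : HilbertBasis ι ℂ E) {i j : ι} (h : i ≠ j) :
    ⟪b i, b j⟫_ℂ = 0 := b.orthonormal.2 h

lemma norm_sq_le_of_sum_le (b : HilbertBasis ι ℂ E) {x : E} {C : ℝ}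
    (h : ∀ G : Finset ι, ∑ i ∈ G, ‖⟪b i, x⟫_ℂ‖ ^ 2 ≤ C) : ‖x‖ ^ 2 ≤ C :=
  le_of_tendsto' (hasSum_norm_sq_inner b x) h

/-- `T` acts on the coordinates in the basis `b` as multiplication by `d`. -/
def IsDiagonal (T : E →L[ℂ] E) (b : HilbertBasis ι ℂ E) (d : ι → ℂ) : Prop :=
  ∀ ψ i, ⟪b i, T ψ⟫_ℂ = d i * ⟪b i, ψ⟫_ℂ

lemma IsDiagonal.inner_apply {T : E →L[ℂ] E} {b : HilbertBasis ι ℂ E} {d : ι → ℂ}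
    (hT : IsDiagonal T b d) (ψ : E) (i : ι) : ⟪b i, T ψ⟫_ℂ = d i * ⟪b i, ψ⟫_ℂ := hT ψ i

lemma IsDiagonal.ext {T S : E →L[ℂ] E} {b : HilbertBasis ι ℂ E} {d : ι → ℂ}
    (hT : IsDiagonal T b d) (hS : IsDiagonal S b d) : T = S := by
  ext x
  exact hilbertBasis_ext b fun i => by rw [hT, hS]

lemma IsDiagonal.apply_basis {T : E →L[ℂ] E} {b : HilbertBasis ι ℂ E} {d : ι → ℂ}
    (hT : IsDiagonal T b d) (i : ι) : T (b i) = d i • b i := by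
  refine hilbertBasis_ext b fun j => ?_
  rw [hT, inner_smul_right]
  rcases eq_or_ne j i with rfl | h
  · rfl
  · rw [inner_hilbertBasis_ne b h]; simp

lemma isDiagonal_of_apply_basis {T : E →L[ℂ] E} {b : HilbertBasis ι ℂ E} {d : ι → ℂ}
    (hT : ∀ i, T (b i) = d i • b i) : IsDiagonal T b d := by
  classical
  intro ψ i
  have h := (b.hasSum_repr ψ).mapL (innerSL ℂ (b i) ∘L T)
  have h2 := (hasSum_ite_eq i (d i * ⟪b i, ψ⟫_ℂ))
  suffices e : (fun j => (innerSL ℂ (b i) ∘L T) (b.repr ψ j • b j)) =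
      fun j => if j = i then d i * ⟪b i, ψ⟫_ℂ else 0 from
    (e ▸ h).unique h2
  funext j
  simp only [ContinuousLinearMap.comp_apply, map_smul, hT, innerSL_apply_apply,
    b.repr_apply_apply, smul_eq_mul]
  rcases eq_or_ne j i with rfl | hj
  · rw [inner_hilbertBasis_self]; simp [mul_comm]
  · rw [inner_hilbertBasis_ne b hj.symm]; simp [hj]

lemma norm_apply_sq_le_of_inner_eq {b : HilbertBasis ι ℂ E} {d : ι → ℂ} {C : ℝ}
    (hd : ∀ i, ‖d i‖ ≤ C) {x y : E} (h : ∀ i, ⟪b i, y⟫_ℂ = d i * ⟪b i, x⟫_ℂ) :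
    ‖y‖ ^ 2 ≤ C ^ 2 * ‖x‖ ^ 2 := by
  refine norm_sq_le_of_sum_le b fun G => ?_
  refine le_trans ?_ (mul_le_mul_of_nonneg_left (sum_norm_sq_inner_le b G x) (sq_nonneg C))
  rw [Finset.mul_sum]
  refine Finset.sum_le_sum fun i _ => ?_
  rw [h, norm_mul, mul_pow]
  gcongr
  exact hd i

lemma exists_isDiagonal (b : HilbertBasis ι ℂ E) (d : ι → ℂ) {C : ℝ}
    (hd : ∀ i, ‖d i‖ ≤ C) : ∃ T : E →L[ℂ] E, IsDiagonal T b d := by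
  have key : ∀ ψ : E, ∃ y, ∀ i, ⟪b i, y⟫_ℂ = d i * ⟪b i, ψ⟫_ℂ := fun ψ => by
    refine exists_inner_eq b _ ?_
    refine Summable.of_nonneg_of_le (fun _ => sq_nonneg _) (fun i => ?_)
      ((hasSum_norm_sq_inner b ψ).summable.mul_left (C ^ 2))
    rw [norm_mul, mul_pow]
    gcongr
    exact hd i
  choose T hT using key
  let L : E →ₗ[ℂ] E :=
    { toFun := T
      map_add' := fun x y => hilbertBasis_ext b fun i => by
        rw [hT, inner_add_right, inner_add_right, hT, hT, mul_add]
      map_smul' := fun z x => hilbertBasis_ext b fun i => by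
        rw [hT, inner_smul_right, RingHom.id_apply, inner_smul_right, hT]; ring }
  refine ⟨L.mkContinuous |C| fun x => ?_, fun ψ i => hT ψ i⟩
  refine abs_le_of_sq_le_sq' ?_ (by positivity) |>.2
  rw [mul_pow, sq_abs]
  exact norm_apply_sq_le_of_inner_eq hd (hT x)

/-! ### Compactness -/

variable [CompleteSpace E]

/-- The hypothesis says that `T` is the norm limit of its truncations to finitely many output
coordinates. These have finite rank, and compact operators are norm closed. -/
lemma isCompactOperator_of_tail (b : HilbertBasis ι ℂ E) (T : E →L[ℂ] E)
    (h : ∀ η > 0, ∃ F : Finset ι, ∀ G : Finset ι, Disjoint G F → ∀ x,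
      ∑ i ∈ G, ‖⟪b i, T x⟫_ℂ‖ ^ 2 ≤ η ^ 2 * ‖x‖ ^ 2) : IsCompactOperator T := by
  classical
  have hcl := isClosed_setOfPred_isCompactOperator (σ₁₂ := RingHom.id ℂ) (M₁ := E) (M₂ := E)
  refine hcl.closure_subset (Metric.mem_closure_iff.2 fun η hη => ?_)
  obtain ⟨F, hF⟩ := h (η / 2) (by positivity)
  let P : E →L[ℂ] E :=
    ∑ i ∈ F, (ContinuousLinearMap.toSpanSingleton ℂ (b i)) ∘L (innerSL ℂ (b i))
  have hP : IsCompactOperator P := by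
    have : ∀ G : Finset ι, (∑ i ∈ G, (ContinuousLinearMap.toSpanSingleton ℂ (b i)) ∘L
        (innerSL ℂ (b i)) : E →L[ℂ] E) ∈ compactOperator (RingHom.id ℂ) E E := fun G =>
      Submodule.sum_mem _ fun i _ =>
        IsCompactOperator.comp_clm (isCompactOperator_of_locallyCompactSpace_rng
          (ContinuousLinearMap.toSpanSingleton ℂ (b i))) (innerSL ℂ (b i))
    exact this F
  refine ⟨P ∘L T, hP.comp_clm T, ?_⟩
  rw [dist_eq_norm]
  refine lt_of_le_of_lt (ContinuousLinearMap.opNorm_le_bound _ (by positivity : 0 ≤ η / 2)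
    fun x => ?_) (half_lt_self hη)
  refine abs_le_of_sq_le_sq' ?_ (by positivity) |>.2
  rw [mul_pow]
  refine norm_sq_le_of_sum_le b fun G => ?_
  have hPi : ∀ y i, ⟪b i, P y⟫_ℂ = if i ∈ F then ⟪b i, y⟫_ℂ else 0 := fun y i => by
    simp only [P, sum_apply, inner_sum, ContinuousLinearMap.comp_apply,
      ContinuousLinearMap.toSpanSingleton_apply, innerSL_apply_apply, inner_smul_right]
    rw [← Finset.sum_ite_eq F i fun j => ⟪b j, y⟫_ℂ]
    refine Finset.sum_congr rfl fun j _ => ?_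
    rcases eq_or_ne i j with rfl | hj
    · rw [inner_hilbertBasis_self]; simp
    · rw [inner_hilbertBasis_ne b hj]; simp [hj]
  refine le_trans (le_of_eq ?_) (hF (G \ F) Finset.sdiff_disjoint x)
  rw [Finset.sdiff_eq_filter, Finset.sum_filter]
  refine Finset.sum_congr rfl fun i _ => ?_
  rw [sub_apply, inner_sub_right, ContinuousLinearMap.comp_apply, hPi]
  split_ifs <;> simp_all

lemma IsDiagonal.isCompactOperator {T : E →L[ℂ] E} {b : HilbertBasis ι ℂ E} {d : ι → ℂ}
    (hT : IsDiagonal T b d) (hd : Filter.Tendsto d Filter.cofinite (nhds 0)) :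
    IsCompactOperator T := by
  refine isCompactOperator_of_tail b T fun η hη => ?_
  have hev : ∀ᶠ i in Filter.cofinite, ‖d i‖ < η := by
    simpa using (Metric.tendsto_nhds.1 hd) η hη
  refine ⟨(Filter.eventually_cofinite.1 hev).toFinset, fun G hG x => ?_⟩
  refine le_trans ?_ (mul_le_mul_of_nonneg_left (sum_norm_sq_inner_le b G x) (sq_nonneg η))
  rw [Finset.mul_sum]
  refine Finset.sum_le_sum fun i hi => ?_
  have h1 : ‖d i‖ < η := by
    by_contra hcon
    exact Finset.disjoint_left.1 hG hi (by simpa using hcon)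
  rw [hT, norm_mul, mul_pow]
  gcongr

/-- Hilbert–Schmidt operators are compact: by symmetry and Cauchy–Schwarz the `i`-th coordinate of
`T x` is at most `‖T (b i)‖ * ‖x‖`, so the tails are uniformly small. -/
lemma isCompactOperator_of_summable_norm_sq {T : E →L[ℂ] E} (hT : IsSelfAdjoint T)
    (b : HilbertBasis ι ℂ E) (h : Summable fun i => ‖T (b i)‖ ^ 2) : IsCompactOperator T := by
  refine isCompactOperator_of_tail b T fun η hη => ?_
  obtain ⟨F, hF⟩ := summable_iff_vanishing_norm.1 h (η ^ 2) (by positivity)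
  refine ⟨F, fun G hG x => ?_⟩
  have h1 := (hF G hG).le
  rw [Real.norm_of_nonneg (Finset.sum_nonneg fun _ _ => sq_nonneg _)] at h1
  refine le_trans ?_ (mul_le_mul_of_nonneg_right h1 (sq_nonneg ‖x‖))
  rw [Finset.sum_mul]
  refine Finset.sum_le_sum fun i _ => ?_
  rw [← mul_pow]
  have h2 : ⟪b i, T x⟫_ℂ = ⟪T (b i), x⟫_ℂ := (hT.isSymmetric (b i) x).symm
  rw [h2]
  gcongr
  exact norm_inner_le_norm _ _

/-! ### The spectral theorem for compact self-adjoint operators -/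

/-- Hilbert bases of the separate eigenspaces are glued together. Distinct eigenspaces are
orthogonal, and compactness makes their joint span dense. The index set is a subset of `E`, as
`IsTraceClass` requires. -/
lemma exists_hilbertBasis_isDiagonal {T : E →L[ℂ] E} (hc : IsCompactOperator T)
    (hT : IsSelfAdjoint T) :
    ∃ (s : Set E) (b : HilbertBasis s ℂ E) (d : s → ℝ), IsDiagonal T b fun i => (d i : ℂ) := by
  have hsym : (T : E →ₗ[ℂ] E).IsSymmetric := hT.isSymmetric
  let V : ℂ → Submodule ℂ E := Module.End.eigenspace (T : Module.End ℂ E)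
  have hcl : ∀ z, IsClosed (V z : Set E) := fun z => by
    have : (V z : Set E) = {x | T x = z • x} := by
      ext x; exact Module.End.mem_eigenspace_iff
    rw [this]
    exact isClosed_eq T.continuous (continuous_const_smul z)
  have hcomp : ∀ z, CompleteSpace (V z) := fun z => (hcl z).completeSpace_coe
  choose w B hB using fun z => (haveI := hcomp z; exists_hilbertBasis ℂ (V z))
  let s : Set E := ⋃ z, (Subtype.val : V z → E) '' w z
  have hmem : ∀ x : s, ∃ z, (x : E) ∈ V z ∧ ∃ h : (x : E) ∈ V z, (⟨x, h⟩ : V z) ∈ w z := by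
    rintro ⟨x, hx⟩
    obtain ⟨z, y, hy, rfl⟩ := Set.mem_iUnion.1 hx
    exact ⟨z, y.2, y.2, hy⟩
  choose z hz hz' hzw using hmem
  have hself : ∀ (z : ℂ) (x : E) (h : x ∈ V z), (⟨x, h⟩ : V z) ∈ w z → ‖x‖ = 1 := by
    intro z x h hx
    have := (B z).orthonormal.1 ⟨_, hx⟩
    rw [hB] at this
    exact this
  have hon : Orthonormal ℂ (Subtype.val : s → E) := by
    refine ⟨fun x => hself _ _ (hz' x) (hzw x), fun x y hxy => ?_⟩
    by_cases hzz : z x = z y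
    · have hy' : (y : E) ∈ V (z x) := hzz ▸ hz y
      -- The set `w` depends on the eigenvalue, so membership is transported along `z x = z y` after
      -- generalizing the proof that `y` lies in its eigenspace.
      have hyw : (⟨y, hy'⟩ : V (z x)) ∈ w (z x) := by
        have := hzw y
        revert this hy'
        generalize hz' y = q
        revert q
        rw [← hzz]
        intro q _ this
        exact this
      have := (B (z x)).orthonormal.2 (i := ⟨_, hzw x⟩) (j := ⟨_, hyw⟩) (by
        intro hcon
        apply hxy
        simpa [Subtype.ext_iff] using hcon)
      rw [hB] at this
      exact this
    · exact hsym.orthogonalFamily_eigenspaces hzz ⟨x, hz x⟩ ⟨y, hz y⟩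
  have hspan : (Submodule.span ℂ (Set.range (Subtype.val : s → E)))ᗮ = ⊥ := by
    rw [Subtype.range_coe]
    have h0 := ContinuousLinearMap.orthogonalComplement_iSup_eigenspaces_eq_bot hc hsym
    rw [← Submodule.orthogonal_closure]
    rw [eq_bot_iff, ← h0]
    refine Submodule.orthogonal_le (iSup_le fun μ => ?_)
    intro x hx
    have hd := (B μ).dense_span
    have hx' : (⟨x, hx⟩ : V μ) ∈ (Submodule.span ℂ (Set.range (B μ))).topologicalClosure := by
      rw [hd]; trivial
    have h1 := map_mem_closure (V μ).subtypeL.continuous hx'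
      (t := (Submodule.span ℂ s : Set E)) (by
        intro y hy
        have : y ∈ Submodule.comap (V μ).subtype (Submodule.span ℂ s) := by
          refine (Submodule.span_le.2 ?_) hy
          rintro _ ⟨i, rfl⟩
          rw [hB]
          exact Submodule.subset_span (Set.mem_iUnion.2 ⟨μ, _, i.2, rfl⟩)
        exact this)
    exact h1
  refine ⟨s, HilbertBasis.mkOfOrthogonalEqBot hon hspan, fun i => (z i).re,
    isDiagonal_of_apply_basis fun i => ?_⟩
  rw [HilbertBasis.coe_mkOfOrthogonalEqBot]
  have h1 : T i = z i • (i : E) := Module.End.mem_eigenspace_iff.1 (hz i)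
  have hi : (i : E) ≠ 0 := hon.ne_zero i
  have h2 := hsym.conj_eigenvalue_eq_self
    (Module.End.hasEigenvalue_of_hasEigenvector ⟨hz i, hi⟩)
  rw [h1, Complex.conj_eq_iff_re.1 h2]

/-! ### Functional calculus and trace of bounded diagonal operators -/

lemma IsDiagonal.isSelfAdjoint {T : E →L[ℂ] E} {b : HilbertBasis ι ℂ E} {d : ι → ℝ}
    (hT : IsDiagonal T b fun i => (d i : ℂ)) : IsSelfAdjoint T := by
  rw [ContinuousLinearMap.isSelfAdjoint_iff']
  refine IsDiagonal.ext (b := b) (d := fun i => (d i : ℂ)) (fun ψ i => ?_) hT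
  rw [ContinuousLinearMap.adjoint_inner_right, hT.apply_basis, inner_smul_left,
    Complex.conj_ofReal]

lemma IsDiagonal.hasSum_inner {T : E →L[ℂ] E} {b : HilbertBasis ι ℂ E} {d : ι → ℝ}
    (hT : IsDiagonal T b fun i => (d i : ℂ)) (x : E) :
    HasSum (fun i => ((d i * ‖⟪b i, x⟫_ℂ‖ ^ 2 : ℝ) : ℂ)) ⟪x, T x⟫_ℂ := by
  have h := b.hasSum_inner_mul_inner x (T x)
  suffices e : (fun i => ⟪x, b i⟫_ℂ * ⟪b i, T x⟫_ℂ) =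
      fun i => ((d i * ‖⟪b i, x⟫_ℂ‖ ^ 2 : ℝ) : ℂ) from e ▸ h
  funext i
  rw [hT, ← inner_conj_symm x (b i), mul_left_comm, ← Complex.normSq_eq_conj_mul_self,
    Complex.normSq_eq_norm_sq, Complex.ofReal_mul]

lemma IsDiagonal.hasSum_re_inner {T : E →L[ℂ] E} {b : HilbertBasis ι ℂ E} {d : ι → ℝ}
    (hT : IsDiagonal T b fun i => (d i : ℂ)) (x : E) :
    HasSum (fun i => d i * ‖⟪b i, x⟫_ℂ‖ ^ 2) (RCLike.re ⟪x, T x⟫_ℂ) :=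
  (hT.hasSum_inner x).mapL Complex.reCLM

lemma IsDiagonal.isPositive {T : E →L[ℂ] E} {b : HilbertBasis ι ℂ E} {d : ι → ℝ}
    (hT : IsDiagonal T b fun i => (d i : ℂ)) (hd : ∀ i, 0 ≤ d i) : T.IsPositive := by
  refine ContinuousLinearMap.isPositive_def'.2 ⟨hT.isSelfAdjoint, fun x => ?_⟩
  rw [ContinuousLinearMap.reApplyInnerSelf_apply, inner_re_symm]
  exact (hT.hasSum_re_inner x).nonneg fun i => mul_nonneg (hd i) (sq_nonneg _)

lemma IsDiagonal.abs_eq {T : E →L[ℂ] E} {b : HilbertBasis ι ℂ E} {d : ι → ℝ}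
    (hT : IsDiagonal T b fun i => (d i : ℂ)) (hd : ∀ i, 0 ≤ d i) : CFC.abs T = T :=
  CFC.abs_of_nonneg T ((ContinuousLinearMap.nonneg_iff_isPositive T).2 (hT.isPositive hd))

lemma IsDiagonal.re_inner_basis {T : E →L[ℂ] E} {b : HilbertBasis ι ℂ E} {d : ι → ℝ}
    (hT : IsDiagonal T b fun i => (d i : ℂ)) (i : ι) : RCLike.re ⟪b i, T (b i)⟫_ℂ = d i := by
  rw [hT, inner_hilbertBasis_self, mul_one]
  exact Complex.ofReal_re _

/-- Terms are nonnegative, and summing over the basis `c` first gives `d i` by Parseval. This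
exchange of sums yields both the basis independence of the trace and the final trace estimate. -/
lemma summable_mul_norm_sq_inner {κ : Type*} (b : HilbertBasis ι ℂ E) (c : HilbertBasis κ ℂ E)
    {d : ι → ℝ} (hd : ∀ i, 0 ≤ d i) (hs : Summable d) :
    Summable fun q : κ × ι => d q.2 * ‖⟪b q.2, c q.1⟫_ℂ‖ ^ 2 := by
  have hrow : ∀ i, HasSum (fun j => d i * ‖⟪b i, c j⟫_ℂ‖ ^ 2) (d i) := fun i => by
    have := (hasSum_norm_sq_inner c (b i)).mul_left (d i)
    rw [b.orthonormal.1, one_pow, mul_one] at this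
    simpa only [norm_inner_symm] using this
  refine Summable.prod_symm (f := fun q : ι × κ => d q.1 * ‖⟪b q.1, c q.2⟫_ℂ‖ ^ 2) ?_
  refine (summable_prod_of_nonneg fun q => mul_nonneg (hd _) (sq_nonneg _)).2
    ⟨fun i => (hrow i).summable, ?_⟩
  simpa only [(hrow _).tsum_eq] using hs

lemma IsDiagonal.isTraceClass {T : E →L[ℂ] E} {b : HilbertBasis ι ℂ E} {d : ι → ℝ}
    (hT : IsDiagonal T b fun i => (d i : ℂ)) (hd : ∀ i, 0 ≤ d i) (hs : Summable d) :
    IsTraceClass T := by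
  intro s c
  rw [hT.abs_eq hd]
  have := (summable_mul_norm_sq_inner b c hd hs).prod
  simpa only [(hT.hasSum_re_inner _).tsum_eq] using this

lemma IsDiagonal.opTrace_eq {T : E →L[ℂ] E} {b : HilbertBasis ι ℂ E} {d : ι → ℝ}
    (hT : IsDiagonal T b fun i => (d i : ℂ)) (hd : ∀ i, 0 ≤ d i) (hs : Summable d) :
    opTrace T = ((∑' i, d i : ℝ) : ℂ) := by
  unfold opTrace
  generalize (exists_hilbertBasis ℂ E).choose_spec.choose = c
  have hp := summable_mul_norm_sq_inner b c hd hs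
  have h1 : ∀ j, ⟪c j, T (c j)⟫_ℂ = ((∑' i, d i * ‖⟪b i, c j⟫_ℂ‖ ^ 2 : ℝ) : ℂ) := fun j => by
    rw [Complex.ofReal_tsum]
    exact (hT.hasSum_inner (c j)).tsum_eq.symm
  simp_rw [h1]
  rw [← Complex.ofReal_tsum, ← Summable.tsum_comm (f := fun j i => d i * ‖⟪b i, c j⟫_ℂ‖ ^ 2) hp]
  congr 2
  funext i
  rw [tsum_mul_left]
  have := (hasSum_norm_sq_inner c (b i)).tsum_eq
  rw [b.orthonormal.1, one_pow] at this
  simp_rw [norm_inner_symm (b i) (c _)]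
  rw [this, mul_one]

lemma IsDiagonal.summable_of_isTraceClass {s : Set E} {T : E →L[ℂ] E} {b : HilbertBasis s ℂ E}
    {d : s → ℝ} (hT : IsDiagonal T b fun i => (d i : ℂ)) (hd : ∀ i, 0 ≤ d i)
    (h : IsTraceClass T) : Summable d := by
  have := h s b
  rw [hT.abs_eq hd] at this
  simpa only [hT.re_inner_basis] using this

/-- The square root of `T` is Hilbert–Schmidt, since `‖T^{1/2} b i‖² = ⟪b i, T (b i)⟫`. Hence it is
compact, and so is its square. -/
lemma IsTraceClass.isCompactOperator {T : E →L[ℂ] E} (hT : T.IsPositive) (h : IsTraceClass T) :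
    IsCompactOperator T := by
  have h0 : 0 ≤ T := (ContinuousLinearMap.nonneg_iff_isPositive T).2 hT
  obtain ⟨s, b, -⟩ := exists_hilbertBasis ℂ E
  have hs := h s b
  rw [CFC.abs_of_nonneg T h0] at hs
  have hsq : CFC.sqrt T * CFC.sqrt T = T := CFC.sqrt_mul_sqrt_self T h0
  have hsa : IsSelfAdjoint (CFC.sqrt T) := IsSelfAdjoint.of_nonneg (CFC.sqrt_nonneg T)
  have hc : IsCompactOperator (CFC.sqrt T : E →L[ℂ] E) := by
    refine isCompactOperator_of_summable_norm_sq hsa b (hs.congr fun i => ?_)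
    conv_lhs => rw [← hsq]
    rw [mul_apply_eq_comp]
    have := hsa.isSymmetric (b i) (CFC.sqrt T (b i))
    rw [ContinuousLinearMap.coe_coe] at this
    rw [← this]
    exact inner_self_eq_norm_sq (𝕜 := ℂ) _
  have := hc.clm_comp (CFC.sqrt T)
  rw [← hsq]
  exact this

/-- Clear for polynomials. In general `f` is approximated uniformly on `[-‖T‖, ‖T‖]`, an interval
that contains both the spectrum and the eigenvalue `r`. -/
lemma cfc_apply_of_apply_eq {T : E →L[ℂ] E} (hT : IsSelfAdjoint T) {f : ℝ → ℝ}
    (hf : Continuous f) {r : ℝ} {v : E} (hv : T v = (r : ℂ) • v) :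
    cfc f T v = (f r : ℂ) • v := by
  rcases eq_or_ne v 0 with rfl | hv0
  · simp
  have : Nontrivial E := ⟨v, 0, hv0⟩
  have hpow : ∀ n : ℕ, (T ^ n) v = ((r ^ n : ℝ) : ℂ) • v := fun n => by
    induction n with
    | zero => simp
    | succ n ih =>
      rw [pow_succ', mul_apply_eq_comp, ih, map_smul, hv, smul_smul]
      push_cast
      ring_nf
  have hpoly : ∀ q : Polynomial ℝ, (Polynomial.aeval T q) v = ((q.eval r : ℝ) : ℂ) • v := by
    intro q
    induction q using Polynomial.induction_on' with
    | add p q hp hq =>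
      rw [map_add, add_apply, hp, hq, Polynomial.eval_add, Complex.ofReal_add, add_smul]
    | monomial n a =>
      rw [Polynomial.aeval_monomial, Polynomial.eval_monomial, ← Algebra.smul_def, smul_apply,
        hpow, ← Complex.coe_smul, smul_smul]
      push_cast
      rfl
  have hr : |r| ≤ ‖T‖ := by
    have := T.le_opNorm v
    rw [hv, norm_smul, Complex.norm_real, Real.norm_eq_abs] at this
    exact le_of_mul_le_mul_right this (norm_pos_iff.2 hv0)
  have hle : ∀ η > 0, ‖cfc f T v - (f r : ℂ) • v‖ ≤ η * (2 * ‖v‖) := by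
    intro η hη
    obtain ⟨q, hq⟩ := exists_polynomial_near_of_continuousOn (-‖T‖) ‖T‖ f hf.continuousOn η hη
    have h1 : ‖cfc f T - cfc q.eval T‖ ≤ η := by
      rw [← cfc_sub f q.eval T hf.continuousOn q.continuous.continuousOn]
      refine norm_cfc_le hη.le fun x hx => ?_
      rw [← norm_sub_rev]
      refine (hq x ?_).le
      have := spectrum.norm_le_norm_of_mem hx
      exact abs_le.1 this
    rw [cfc_polynomial q T hT] at h1
    have h2 : cfc f T v - (f r : ℂ) • v =
        (cfc f T - Polynomial.aeval T q) v + ((q.eval r - f r : ℝ) : ℂ) • v := by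
      rw [sub_apply, hpoly]
      push_cast
      rw [sub_smul]
      abel
    rw [h2]
    refine (norm_add_le _ _).trans ?_
    have h3 := (cfc f T - Polynomial.aeval T q).le_of_opNorm_le h1 v
    have h4 : ‖((q.eval r - f r : ℝ) : ℂ) • v‖ ≤ η * ‖v‖ := by
      rw [norm_smul, Complex.norm_real]
      gcongr
      exact (hq r (abs_le.1 hr)).le
    linarith
  rw [← sub_eq_zero, ← norm_le_zero_iff]
  refine le_of_forall_pos_le_add fun δ hδ => ?_
  have hv1 : 0 < 2 * ‖v‖ := by positivity
  have := hle (δ / (2 * ‖v‖)) (by positivity)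
  rwa [div_mul_cancel₀ _ hv1.ne', ← zero_add δ] at this

lemma IsDiagonal.rpow {T : E →L[ℂ] E} {b : HilbertBasis ι ℂ E} {d : ι → ℝ}
    (hT : IsDiagonal T b fun i => (d i : ℂ)) (hd : ∀ i, 0 ≤ d i) {p : ℝ} (hp : 0 ≤ p) :
    IsDiagonal (T ^ p) b fun i => ((d i ^ p : ℝ) : ℂ) := by
  have h0 : 0 ≤ T := (ContinuousLinearMap.nonneg_iff_isPositive T).2 (hT.isPositive hd)
  rw [CFC.rpow_eq_cfc_real h0]
  exact isDiagonal_of_apply_basis fun i =>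
    cfc_apply_of_apply_eq hT.isSelfAdjoint (Real.continuous_rpow_const hp) (hT.apply_basis i)

/-! ### Unbounded diagonal operators -/

/-- `A` is the maximal operator acting on the coordinates in the basis `b` as multiplication
by the real numbers `d i`. -/
structure IsDiag (A : E →ₗ.[ℂ] E) (b : HilbertBasis ι ℂ E) (d : ι → ℝ) : Prop where
  mem_domain_iff : ∀ ψ, ψ ∈ A.domain ↔ Summable fun i => d i ^ 2 * ‖⟪b i, ψ⟫_ℂ‖ ^ 2
  inner_apply : ∀ (ψ : A.domain) i, ⟪b i, A ψ⟫_ℂ = d i * ⟪b i, (ψ : E)⟫_ℂ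

lemma norm_sq_ofReal_mul (r : ℝ) (z : ℂ) : ‖(r : ℂ) * z‖ ^ 2 = r ^ 2 * ‖z‖ ^ 2 := by
  rw [norm_mul, mul_pow, Complex.norm_real, Real.norm_eq_abs, sq_abs]

lemma IsDiagonal.isDiag_ofBounded {T : E →L[ℂ] E} {b : HilbertBasis ι ℂ E} {d : ι → ℝ}
    (hT : IsDiagonal T b fun i => (d i : ℂ)) : IsDiag (ofBounded T) b d := by
  refine ⟨fun ψ => ⟨fun _ => ?_, fun _ => Submodule.mem_top⟩, fun ψ i => hT ψ i⟩
  simpa only [hT ψ _, norm_sq_ofReal_mul] using (hasSum_norm_sq_inner b (T ψ)).summable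

/-- The domain is maximal, hence determined by `b` and `d`. This is how functions of an unbounded
operator are recognized as bounded operators. -/
lemma IsDiag.ext {A B : E →ₗ.[ℂ] E} {b : HilbertBasis ι ℂ E} {d : ι → ℝ}
    (hA : IsDiag A b d) (hB : IsDiag B b d) : A = B := by
  refine LinearPMap.ext (Submodule.ext fun ψ => ?_) fun ψ h1 h2 => hilbertBasis_ext b fun i => ?_
  · rw [hA.mem_domain_iff, hB.mem_domain_iff]
  · rw [hA.inner_apply, hB.inner_apply]

lemma ofBounded_injective : Function.Injective (ofBounded : (E →L[ℂ] E) → E →ₗ.[ℂ] E) := by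
  intro T S h
  ext x
  exact (LinearPMap.ext_iff.1 h).2 (x := x) (hf := Submodule.mem_top) (hg := Submodule.mem_top)

lemma toBounded_ofBounded (T : E →L[ℂ] E) : toBounded (ofBounded T) = T := by
  have h : ∃ S : E →L[ℂ] E, ofBounded S = ofBounded T := ⟨T, rfl⟩
  rw [toBounded, dif_pos h]
  exact ofBounded_injective h.choose_spec

lemma IsDiag.basis_mem {A : E →ₗ.[ℂ] E} {b : HilbertBasis ι ℂ E} {d : ι → ℝ}
    (hA : IsDiag A b d) (i : ι) : b i ∈ A.domain := by
  rw [hA.mem_domain_iff]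
  refine summable_of_ne_finset_zero (s := {i}) fun j hj => ?_
  rw [inner_hilbertBasis_ne b (by simpa using hj)]
  simp

lemma IsDiag.apply_basis {A : E →ₗ.[ℂ] E} {b : HilbertBasis ι ℂ E} {d : ι → ℝ}
    (hA : IsDiag A b d) (i : ι) : A ⟨b i, hA.basis_mem i⟩ = (d i : ℂ) • b i := by
  refine hilbertBasis_ext b fun j => ?_
  rw [hA.inner_apply, inner_smul_right]
  rcases eq_or_ne j i with rfl | h
  · rfl
  · rw [inner_hilbertBasis_ne b h]; simp

lemma mem_eigenspace_iff {A : E →ₗ.[ℂ] E} {z : ℂ} {ψ : E} :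
    ψ ∈ eigenspace A z ↔ ∃ h : ψ ∈ A.domain, A ⟨ψ, h⟩ = z • ψ := by
  unfold eigenspace
  rw [Submodule.mem_map]
  constructor
  · rintro ⟨φ, hφ, rfl⟩
    exact ⟨φ.2, sub_eq_zero.1 hφ⟩
  · rintro ⟨h, h'⟩
    exact ⟨⟨ψ, h⟩, sub_eq_zero.2 h', rfl⟩

lemma IsDiag.mem_eigenspace_iff {A : E →ₗ.[ℂ] E} {b : HilbertBasis ι ℂ E} {d : ι → ℝ}
    (hA : IsDiag A b d) {z : ℂ} {ψ : E} :
    ψ ∈ eigenspace A z ↔ ∀ i, (d i : ℂ) = z ∨ ⟪b i, ψ⟫_ℂ = 0 := by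
  rw [QuantumInfo.mem_eigenspace_iff]
  constructor
  · rintro ⟨h, h'⟩ i
    have := hA.inner_apply ⟨ψ, h⟩ i
    rw [h', inner_smul_right] at this
    exact (mul_eq_mul_right_iff.1 this).imp_left Eq.symm
  · intro h
    have hψ : ψ ∈ A.domain := by
      rw [hA.mem_domain_iff]
      refine ((hasSum_norm_sq_inner b ψ).summable.mul_left (‖z‖ ^ 2)).congr fun i => ?_
      rcases h i with hi | hi
      · rw [← hi, Complex.norm_real, Real.norm_eq_abs, sq_abs]
      · simp [hi]
    refine ⟨hψ, hilbertBasis_ext b fun i => ?_⟩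
    rw [hA.inner_apply, inner_smul_right]
    rcases h i with hi | hi
    · rw [hi]
    · simp [hi]

open Classical in
lemma IsDiag.inner_eigenProj {A : E →ₗ.[ℂ] E} {b : HilbertBasis ι ℂ E} {d : ι → ℝ}
    (hA : IsDiag A b d) (x : ℝ) (ψ : E) (i : ι) :
    ⟪b i, eigenProj A x ψ⟫_ℂ = if d i = x then ⟪b i, ψ⟫_ℂ else 0 := by
  -- The candidate projection is the multiplication by the indicator of `{i | d i = x}`.
  obtain ⟨P, hP⟩ := exists_isDiagonal b (fun i => if d i = x then (1 : ℂ) else 0) (C := 1)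
    (fun i => by split_ifs <;> simp)
  have hmem : P ψ ∈ eigenspace A (x : ℂ) := hA.mem_eigenspace_iff.2 fun j => by
    rw [hP]
    by_cases h : d j = x
    · exact Or.inl (congrArg _ h)
    · exact Or.inr (by simp [h])
  have : eigenProj A x ψ = P ψ := by
    refine Submodule.eq_starProjection_of_mem_of_inner_eq_zero
      (Submodule.le_topologicalClosure _ hmem) ?_
    suffices ψ - P ψ ∈ (eigenspace A (x : ℂ)).topologicalClosureᗮ from fun w hw =>
      Submodule.inner_left_of_mem_orthogonal hw this
    rw [Submodule.orthogonal_closure, Submodule.mem_orthogonal]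
    intro v hv
    have h := b.hasSum_inner_mul_inner v (ψ - P ψ)
    refine h.unique ?_
    convert hasSum_zero with j
    rw [inner_sub_right, hP]
    rcases hA.mem_eigenspace_iff.1 hv j with hj | hj
    · have : d j = x := by exact_mod_cast hj
      simp [this]
    · rw [← inner_conj_symm, hj]; simp
  rw [this, hP]
  by_cases h : d i = x <;> simp [h]

lemma IsDiag.orthogonalFamily {A : E →ₗ.[ℂ] E} {b : HilbertBasis ι ℂ E} {d : ι → ℝ}
    (hA : IsDiag A b d) :
    OrthogonalFamily ℂ (fun x : ℝ => eigenspace A (x : ℂ))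
      fun x => (eigenspace A (x : ℂ)).subtypeₗᵢ := by
  intro x y hxy v w
  refine (b.hasSum_inner_mul_inner (v : E) (w : E)).unique ?_
  convert hasSum_zero with j
  rcases hA.mem_eigenspace_iff.1 v.2 j with hj | hj
  · rcases hA.mem_eigenspace_iff.1 w.2 j with hj' | hj'
    · exact absurd (by exact_mod_cast hj.symm.trans hj') hxy
    · rw [hj', mul_zero]
  · rw [← inner_conj_symm, hj]; simp

lemma IsDiag.eigenProj_mem {A : E →ₗ.[ℂ] E} {b : HilbertBasis ι ℂ E} {d : ι → ℝ}
    (hA : IsDiag A b d) (x : ℝ) (ψ : E) : eigenProj A x ψ ∈ eigenspace A (x : ℂ) := by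
  classical
  refine hA.mem_eigenspace_iff.2 fun i => ?_
  rw [hA.inner_eigenProj]
  by_cases h : d i = x
  · exact Or.inl (congrArg _ h)
  · exact Or.inr (if_neg h)

lemma IsDiag.inner_tsum_eigenProj {A : E →ₗ.[ℂ] E} {b : HilbertBasis ι ℂ E} {d : ι → ℝ}
    (hA : IsDiag A b d) {f : ℝ → ℝ} {ψ : E}
    (h : Summable fun x : ℝ => (f x : ℂ) • eigenProj A x ψ) (i : ι) :
    ⟪b i, ∑' x : ℝ, (f x : ℂ) • eigenProj A x ψ⟫_ℂ = f (d i) * ⟪b i, ψ⟫_ℂ := by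
  classical
  have h1 := h.hasSum.mapL (innerSL ℂ (b i))
  rw [innerSL_apply_apply] at h1
  refine h1.unique ?_
  suffices e : (fun x : ℝ => innerSL ℂ (b i) ((f x : ℂ) • eigenProj A x ψ)) =
      fun x => if x = d i then f (d i) * ⟪b i, ψ⟫_ℂ else 0 from
    e ▸ hasSum_ite_eq (d i) (f (d i) * ⟪b i, ψ⟫_ℂ)
  funext x
  rw [innerSL_apply_apply, inner_smul_right, hA.inner_eigenProj]
  rcases eq_or_ne x (d i) with rfl | hx
  · simp
  · simp [hx, hx.symm]

/-- The functional calculus of a diagonal operator. -/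
lemma IsDiag.funCalc {A : E →ₗ.[ℂ] E} {b : HilbertBasis ι ℂ E} {d : ι → ℝ}
    (hA : IsDiag A b d) (f : ℝ → ℝ) : IsDiag (funCalc A f) b fun i => f (d i) := by
  classical
  refine ⟨fun ψ => ?_, fun ψ i => hA.inner_tsum_eigenProj ψ.2 i⟩
  change (Summable fun x : ℝ => (f x : ℂ) • eigenProj A x ψ) ↔ _
  constructor
  · intro h
    have := (hasSum_norm_sq_inner b (∑' x : ℝ, (f x : ℂ) • eigenProj A x ψ)).summable
    simpa only [hA.inner_tsum_eigenProj h, norm_sq_ofReal_mul] using this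
  · intro h
    -- An orthogonal series converges exactly when its squared norms are summable.
    have hfam := hA.orthogonalFamily.summable_iff_norm_sq_summable
      (fun x => ⟨(f x : ℂ) • eigenProj A x ψ,
        Submodule.smul_mem _ _ (hA.eigenProj_mem x ψ)⟩)
    refine hfam.2 ?_
    -- The given family is spread over the graph `x = d i`. Summing `g` over `i` at fixed `x` gives
    -- the squared norm of the `x`-th term.
    let g : ℝ × ι → ℝ := fun q =>
      if d q.2 = q.1 then f (d q.2) ^ 2 * ‖⟪b q.2, ψ⟫_ℂ‖ ^ 2 else 0
    have hg : Summable g := by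
      have hinj : Function.Injective fun i => (d i, i) := fun i j hij => (Prod.ext_iff.1 hij).2
      refine (hinj.summable_iff fun q hq => if_neg fun hcon => hq ⟨q.2, ?_⟩).1 ?_
      · exact Prod.ext hcon rfl
      · exact h.congr fun i => (if_pos rfl).symm
    refine hg.prod.congr fun x => ?_
    have h2 := hasSum_norm_sq_inner b ((f x : ℂ) • eigenProj A x ψ)
    refine Eq.trans ?_ h2.tsum_eq
    refine tsum_congr fun i => ?_
    rw [inner_smul_right, norm_sq_ofReal_mul, hA.inner_eigenProj]
    by_cases hi : d i = x
    · simp [g, hi]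
    · simp [g, hi]

lemma IsDiag.dense_domain {A : E →ₗ.[ℂ] E} {b : HilbertBasis ι ℂ E} {d : ι → ℝ}
    (hA : IsDiag A b d) : Dense (A.domain : Set E) := by
  have h : Dense (Submodule.span ℂ (Set.range b) : Set E) :=
    Submodule.dense_iff_topologicalClosure_eq_top.2 b.dense_span
  refine h.mono (Submodule.span_le.2 ?_)
  rintro _ ⟨i, rfl⟩
  exact hA.basis_mem i

/-- Symmetry is termwise. Conversely, for `y` in the adjoint domain, testing against `b i` shows
that the coordinates of the adjoint value have modulus `|d i| * ‖⟪b i, y⟫‖`. They are square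
summable, so `y` lies in the maximal domain. -/
lemma IsDiag.isSelfAdjoint {A : E →ₗ.[ℂ] E} {b : HilbertBasis ι ℂ E} {d : ι → ℝ}
    (hA : IsDiag A b d) : IsSelfAdjoint A := by
  have hd := hA.dense_domain
  have hformal : A.IsFormalAdjoint A := fun x y => by
    refine (b.hasSum_inner_mul_inner (A x) (y : E)).unique ?_
    have := b.hasSum_inner_mul_inner (x : E) (A y)
    suffices e : (fun i => ⟪(x : E), b i⟫_ℂ * ⟪b i, A y⟫_ℂ) =
      fun i => ⟪A x, b i⟫_ℂ * ⟪b i, (y : E)⟫_ℂ from e ▸ this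
    funext i
    rw [hA.inner_apply, ← inner_conj_symm (A x), hA.inner_apply, map_mul, Complex.conj_ofReal,
      inner_conj_symm]
    ring
  rw [LinearPMap.isSelfAdjoint_def]
  have hle : A ≤ A.adjoint := hformal.le_adjoint hd
  refine (LinearPMap.eq_of_le_of_domain_eq hle (le_antisymm hle.1 fun y hy => ?_)).symm
  rw [hA.mem_domain_iff]
  have h := (hasSum_norm_sq_inner b (A.adjoint ⟨y, hy⟩)).summable
  refine h.congr fun i => ?_
  have := LinearPMap.adjoint_isFormalAdjoint hd ⟨y, hy⟩ ⟨b i, hA.basis_mem i⟩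
  rw [hA.apply_basis, inner_smul_right] at this
  rw [← norm_sq_ofReal_mul, norm_inner_symm, this, norm_mul, norm_mul, norm_inner_symm (b i)]

/-- Off the range of `d`, the resolvent is multiplication by `(d i - z)⁻¹`, bounded because `d`
tends to infinity. -/
lemma IsDiag.opSpectrum_subset {A : E →ₗ.[ℂ] E} {b : HilbertBasis ι ℂ E} {d : ι → ℝ}
    (hA : IsDiag A b d) (hd : Filter.Tendsto d Filter.cofinite Filter.atTop) :
    opSpectrum A ⊆ Set.range fun i => (d i : ℂ) := by
  intro z hz
  by_contra hcon
  apply hz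
  have hne : ∀ i, (d i : ℂ) - z ≠ 0 := fun i h => hcon ⟨i, sub_eq_zero.1 h⟩
  have hlim : Filter.Tendsto (fun i => ‖((d i : ℂ) - z)⁻¹‖) Filter.cofinite (nhds 0) := by
    simp_rw [norm_inv]
    refine Filter.Tendsto.inv_tendsto_atTop ?_
    refine Filter.tendsto_atTop_mono (fun i => ?_) (Filter.tendsto_atTop_add_const_right _ (-‖z‖) hd)
    have h1 := norm_sub_norm_le (d i : ℂ) z
    have h2 := Complex.re_le_norm (d i : ℂ)
    rw [Complex.ofReal_re] at h2
    linarith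
  obtain ⟨C, hC⟩ := hlim.bddAbove_range_of_cofinite
  have hC' : ∀ i, ‖((d i : ℂ) - z)⁻¹‖ ≤ C := fun i => hC ⟨i, rfl⟩
  obtain ⟨R, hR⟩ := exists_isDiagonal b _ hC'
  have hmem : ∀ y, R y ∈ A.domain := fun y => by
    rw [hA.mem_domain_iff]
    refine Summable.of_nonneg_of_le (fun i => by positivity) (fun i => ?_)
      ((hasSum_norm_sq_inner b y).summable.mul_left ((1 + ‖z‖ * C) ^ 2))
    rw [← norm_sq_ofReal_mul, hR, ← mul_assoc, norm_mul, mul_pow]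
    gcongr
    -- This identity bounds `d i * (d i - z)⁻¹` uniformly, so `R` maps into the domain.
    have : (d i : ℂ) * ((d i : ℂ) - z)⁻¹ = 1 + z * ((d i : ℂ) - z)⁻¹ := by
      field_simp [hne i]
      ring
    rw [this]
    refine (norm_add_le _ _).trans ?_
    rw [norm_one, norm_mul]
    gcongr
    exact hC' i
  refine ⟨R, fun y => ⟨hmem y, hilbertBasis_ext b fun i => ?_⟩,
    fun x => hilbertBasis_ext b fun i => ?_⟩
  · rw [inner_sub_right, hA.inner_apply, inner_smul_right, hR]
    field_simp [hne i]
  · rw [hR, inner_sub_right, hA.inner_apply, inner_smul_right]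
    field_simp [hne i]

lemma IsDiag.hasPurelyDiscreteSpectrum {A : E →ₗ.[ℂ] E} {b : HilbertBasis ι ℂ E} {d : ι → ℝ}
    (hA : IsDiag A b d) (hd : Filter.Tendsto d Filter.cofinite Filter.atTop) :
    HasPurelyDiscreteSpectrum A := by
  intro z hz
  have hsub := hA.opSpectrum_subset hd
  have hfin : ∀ r : ℝ, {i | d i < r}.Finite := fun r => by
    simpa only [not_le] using Filter.eventually_cofinite.1 (hd.eventually_ge_atTop r)
  refine ⟨?_, ?_, ?_⟩
  · let K : Set ℂ := ((fun i => (d i : ℂ)) '' {i | d i < ‖z‖ + 1}) \ {z}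
    have hK : IsClosed K := (((hfin _).image _).subset Set.sdiff_subset).isClosed
    obtain ⟨δ, hδ, hball⟩ := Metric.isOpen_iff.1 hK.isOpen_compl z (fun h => h.2 rfl)
    refine ⟨min δ 1, lt_min hδ one_pos, fun w hw hwz => ?_⟩
    by_contra hne
    obtain ⟨i, rfl⟩ := hsub hw
    refine hball (Metric.mem_ball.2 (hwz.trans_le (min_le_left _ _))) ⟨⟨i, ?_, rfl⟩, hne⟩
    have h1 : ‖(d i : ℂ) - z‖ < 1 := by
      rw [← dist_eq_norm]; exact hwz.trans_le (min_le_right _ _)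
    have h2 := norm_sub_norm_le (d i : ℂ) z
    have h3 := Complex.re_le_norm (d i : ℂ)
    rw [Complex.ofReal_re] at h3
    change d i < ‖z‖ + 1
    linarith
  · obtain ⟨i, rfl⟩ := hsub hz
    intro hbot
    have : b i ∈ eigenspace A (d i : ℂ) :=
      QuantumInfo.mem_eigenspace_iff.2 ⟨hA.basis_mem i, hA.apply_basis i⟩
    rw [hbot, Submodule.mem_bot] at this
    exact b.orthonormal.ne_zero i this
  · have hF := hfin (‖z‖ + 1)
    have hfd : FiniteDimensional ℂ (Submodule.span ℂ (b '' {i | d i < ‖z‖ + 1})) :=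
      FiniteDimensional.span_of_finite ℂ (hF.image b)
    refine Submodule.finiteDimensional_of_le (S₂ := Submodule.span ℂ (b '' {i | d i < ‖z‖ + 1}))
      fun ψ hψ => ?_
    have h0 := hA.mem_eigenspace_iff.1 hψ
    have h1 : HasSum (fun i => b.repr ψ i • b i) (∑ i ∈ hF.toFinset, b.repr ψ i • b i) := by
      refine hasSum_sum_of_ne_finset_zero fun i hi => ?_
      rw [b.repr_apply_apply]
      rcases h0 i with h | h
      · refine absurd ?_ hi
        rw [Set.Finite.mem_toFinset, Set.mem_ofPred_eq, ← h, Complex.norm_real, Real.norm_eq_abs]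
        exact (le_abs_self _).trans_lt (lt_add_one _)
      · rw [h, zero_smul]
    rw [(b.hasSum_repr ψ).unique h1]
    exact Submodule.sum_mem _ fun i hi => Submodule.smul_mem _ _ (Submodule.subset_span
      ⟨i, (Set.Finite.mem_toFinset hF).1 hi, rfl⟩)

/-! ### The operator of a form `q(S x, S y) = ⟨x, K y⟩` -/

/-- For `x = S w`, the defining identity of the form operator becomes `K w = S y`, that is, `x = S
K' S y`. The graph is thus that of the inverse of `S K' S`. -/
lemma formOperator_isDiag {Q : Submodule ℂ E} {q : Q →ₗ⋆[ℂ] Q →ₗ[ℂ] ℂ} {S K K' : E →L[ℂ] E}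
    (hS : IsSelfAdjoint S) (hQ : ∀ z, z ∈ Q ↔ ∃ x, z = S x)
    (hq : ∀ (u v : Q) (x y : E), (u : E) = S x → (v : E) = S y → q u v = ⟪x, K y⟫_ℂ)
    (hK : K * K' = 1) (hK' : K' * K = 1) {f : HilbertBasis ι ℂ E} {r : ι → ℝ}
    (hr : ∀ i, r i ≠ 0) (hR : IsDiagonal (S * K' * S) f fun i => (r i : ℂ)) :
    IsDiag (formOperator q) f fun i => (r i)⁻¹ := by
  have hSin : ∀ x y, ⟪x, S y⟫_ℂ = ⟪S x, y⟫_ℂ := fun x y => (hS.isSymmetric x y).symm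
  obtain ⟨g, hgq, hgmem⟩ : ∃ g : Submodule ℂ (E × E), formOperator q = g.toLinearPMap ∧
      ∀ x y, (x, y) ∈ g ↔ ∃ h : x ∈ Q, ∀ v : Q, q v ⟨x, h⟩ = ⟪(v : E), y⟫_ℂ :=
    ⟨_, rfl, fun _ _ => Iff.rfl⟩
  rw [hgq]
  have hmem : ∀ z : E × E, z ∈ g ↔ z.1 = (S * K' * S) z.2 := by
    rintro ⟨x, y⟩
    rw [hgmem]
    constructor
    · rintro ⟨h, hv⟩
      obtain ⟨w, rfl⟩ := (hQ x).1 h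
      have h1 : K w = S y := by
        refine ext_inner_left ℂ fun u => ?_
        rw [← hq ⟨S u, (hQ _).2 ⟨u, rfl⟩⟩ ⟨S w, h⟩ u w rfl rfl, hv, hSin]
      have h2 : w = K' (S y) := by
        rw [← h1, ← mul_apply_eq_comp, hK', one_apply_eq_self]
      rw [h2]
      rfl
    · intro h
      have hx : x = S (K' (S y)) := h
      refine ⟨(hQ x).2 ⟨_, hx⟩, fun v => ?_⟩
      obtain ⟨u, hu⟩ := (hQ v).1 v.2
      rw [hq v _ u (K' (S y)) hu hx, ← mul_apply_eq_comp, hK, one_apply_eq_self, hSin, hu]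
  -- The relation is single-valued, which `toLinearPMap` needs in order to have `g` as its graph.
  have hg : ∀ z ∈ g, z.1 = 0 → z.2 = 0 := by
    intro z hz h0
    rw [hmem, h0] at hz
    refine hilbertBasis_ext f fun i => ?_
    have := hR.inner_apply z.2 i
    rw [← hz, inner_zero_right] at this
    rw [inner_zero_right]
    exact (mul_eq_zero.1 this.symm).resolve_left (by exact_mod_cast hr i)
  have hval : ∀ ψ : g.toLinearPMap.domain,
      (ψ : E) = (S * K' * S) (g.toLinearPMap ψ) := fun ψ =>
    (hmem _).1 (Submodule.mem_graph_toLinearPMap hg ψ)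
  have hcoord : ∀ (ψ : g.toLinearPMap.domain) i,
      ⟪f i, g.toLinearPMap ψ⟫_ℂ = ((r i)⁻¹ : ℝ) * ⟪f i, (ψ : E)⟫_ℂ := fun ψ i => by
    conv_rhs => rw [hval ψ]
    have hri : (r i : ℂ) ≠ 0 := by exact_mod_cast hr i
    rw [hR.inner_apply, Complex.ofReal_inv, inv_mul_cancel_left₀ hri]
  refine ⟨fun ψ => ⟨fun hψ => ?_, fun h => ?_⟩, hcoord⟩
  · refine (hasSum_norm_sq_inner f (g.toLinearPMap ⟨ψ, hψ⟩)).summable.congr fun i => ?_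
    rw [hcoord, norm_sq_ofReal_mul]
  · obtain ⟨y, hy⟩ := exists_inner_eq f (fun i => (((r i)⁻¹ : ℝ) : ℂ) * ⟪f i, ψ⟫_ℂ)
      (h.congr fun i => (norm_sq_ofReal_mul _ _).symm)
    rw [Submodule.toLinearPMap_domain]
    refine Submodule.mem_map.2 ⟨(ψ, y), (hmem _).2 (hilbertBasis_ext f fun i => ?_), rfl⟩
    have hri : (r i : ℂ) ≠ 0 := by exact_mod_cast hr i
    rw [hR.inner_apply, hy, Complex.ofReal_inv, mul_inv_cancel_left₀ hri]

/-- A bounded Hermitian sesquilinear form is represented by a self-adjoint bounded operator. -/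
lemma exists_isSelfAdjoint_of_form (W : E →ₗ⋆[ℂ] E →ₗ[ℂ] ℂ) (hW : ∀ x y, W y x = conj (W x y))
    {a : ℝ} (ha : 0 ≤ a) (hb : ∀ x y, ‖W x y‖ ≤ a * ‖x‖ * ‖y‖) :
    ∃ B : E →L[ℂ] E, IsSelfAdjoint B ∧ ‖B‖ ≤ a ∧ ∀ x y, W x y = ⟪x, B y⟫_ℂ := by
  let W' : E →L⋆[ℂ] E →L[ℂ] ℂ := W.mkContinuous₂ a hb
  let B := InnerProductSpace.continuousLinearMapOfBilin W'
  have hB : ∀ x y, ⟪B x, y⟫_ℂ = W x y := fun x y =>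
    InnerProductSpace.continuousLinearMapOfBilin_apply W' x y
  have hB' : ∀ x y, ⟪x, B y⟫_ℂ = W x y := fun x y => by
    rw [← inner_conj_symm, hB, ← hW]
  refine ⟨B, ?_, ?_, fun x y => (hB' x y).symm⟩
  · rw [ContinuousLinearMap.isSelfAdjoint_iff_isSymmetric]
    intro x y
    exact (hB x y).trans (hB' x y).symm
  · refine B.opNorm_le_bound ha fun x => ?_
    rcases eq_or_ne (B x) 0 with h0 | h0
    · rw [h0, norm_zero]; positivity
    · have h1 := hb x (B x)
      rw [← hB, inner_self_eq_norm_sq_to_K, norm_pow, RCLike.norm_ofReal, abs_norm] at h1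
      exact le_of_mul_le_mul_right (by linarith) (norm_pos_iff.2 h0)

/-! ### Form perturbations of a diagonal operator -/

/-- Jensen's inequality for the convex function `t ↦ exp (-(p * t))`, obtained by averaging its
tangent line at the mean `m`. -/
lemma exp_neg_mul_le_tsum {w h : ι → ℝ} (hw : ∀ i, 0 ≤ w i) (hw1 : HasSum w 1) {m : ℝ}
    (hm : HasSum (fun i => h i * w i) m) (p : ℝ)
    (hs : Summable fun i => Real.exp (-(p * h i)) * w i) :
    Real.exp (-(p * m)) ≤ ∑' i, Real.exp (-(p * h i)) * w i := by
  have h1 : HasSum (fun i => Real.exp (-(p * m)) * ((1 + p * m) * w i - p * (h i * w i)))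
      (Real.exp (-(p * m)) * ((1 + p * m) * 1 - p * m)) :=
    ((hw1.mul_left _).sub (hm.mul_left p)).mul_left _
  have h2 := hasSum_le (fun i => ?_) h1 hs.hasSum
  · linarith
  · have h3 := Real.add_one_le_exp (p * m - p * h i)
    have h4 : Real.exp (-(p * h i)) = Real.exp (-(p * m)) * Real.exp (p * m - p * h i) := by
      rw [← Real.exp_add]; ring_nf
    rw [h4, mul_assoc]
    refine mul_le_mul_of_nonneg_left ?_ (Real.exp_pos _).le
    nlinarith [mul_le_mul_of_nonneg_right h3 (hw i)]

/-- A bounded inverse square root of a diagonal operator `H ≥ I`, with its basic properties. -/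
lemma IsDiag.exists_sqrtResolvent {H : E →ₗ.[ℂ] E} {b : HilbertBasis ι ℂ E} {h : ι → ℝ}
    (hH : IsDiag H b h) (hh : ∀ i, 1 ≤ h i) :
    ∃ S : E →L[ℂ] E, IsDiagonal S b (fun i => (((Real.sqrt (h i))⁻¹ : ℝ) : ℂ)) ∧
      sqrtResolvent H = ofBounded S ∧ (∀ z, z ∈ formDomain H ↔ ∃ x, z = S x) ∧
      ∀ (u : formDomain H) (x : E), (u : E) = S x → sqrtOp H u = x := by
  have hpos : ∀ i, 0 < Real.sqrt (h i) := fun i => Real.sqrt_pos.2 (by linarith [hh i])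
  have hne : ∀ i, (Real.sqrt (h i) : ℂ) ≠ 0 := fun i => by exact_mod_cast (hpos i).ne'
  obtain ⟨S, hS⟩ := exists_isDiagonal b (fun i => (((Real.sqrt (h i))⁻¹ : ℝ) : ℂ)) (C := 1)
    (fun i => by
      rw [Complex.norm_real, Real.norm_of_nonneg (inv_nonneg.2 (hpos i).le)]
      exact inv_le_one_of_one_le₀ (Real.one_le_sqrt.2 (hh i)))
  have hsq : IsDiag (sqrtOp H) b fun i => Real.sqrt (h i) := hH.funCalc _
  have hcoord : ∀ x i, (Real.sqrt (h i) : ℂ) * ⟪b i, S x⟫_ℂ = ⟪b i, x⟫_ℂ := fun x i => by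
    rw [hS.inner_apply, Complex.ofReal_inv, mul_inv_cancel_left₀ (hne i)]
  refine ⟨S, hS, (hH.funCalc _).ext hS.isDiag_ofBounded, fun z => ?_, fun u x hu => ?_⟩
  · rw [formDomain, hsq.mem_domain_iff]
    constructor
    · intro hz
      obtain ⟨x, hx⟩ := exists_inner_eq b (fun i => (Real.sqrt (h i) : ℂ) * ⟪b i, z⟫_ℂ)
        (hz.congr fun i => (norm_sq_ofReal_mul _ _).symm)
      refine ⟨x, hilbertBasis_ext b fun i => ?_⟩
      rw [hS.inner_apply, hx, Complex.ofReal_inv, inv_mul_cancel_left₀ (hne i)]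
    · rintro ⟨x, rfl⟩
      refine (hasSum_norm_sq_inner b x).summable.congr fun i => ?_
      rw [← norm_sq_ofReal_mul, hcoord]
  · refine hilbertBasis_ext b fun i => ?_
    rw [← hcoord x i, ← hu]
    exact hsq.inner_apply u i

/-- The supremum controls unit vectors; homogeneity gives the rest. Zero vectors cannot be
normalized and are treated apart. -/
lemma norm_apply_le_of_formNorm_lt {H : E →ₗ.[ℂ] E} {S : E →L[ℂ] E}
    (hS : sqrtResolvent H = ofBounded S)
    {V : formDomain H →ₗ⋆[ℂ] formDomain H →ₗ[ℂ] ℂ} {a : ℝ}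
    (hV : formNorm H V < ENNReal.ofReal a) {u v : formDomain H} {x y : E}
    (hu : (u : E) = S x) (hv : (v : E) = S y) : ‖V u v‖ ≤ a * ‖x‖ * ‖y‖ := by
  have hunit : ∀ (u v : formDomain H) (x y : E), (u : E) = S x → (v : E) = S y →
      ‖x‖ ≤ 1 → ‖y‖ ≤ 1 → ‖V u v‖ ≤ a := by
    intro u v x y hu hv hx hy
    have hdom : ∀ z, z ∈ (sqrtResolvent H).domain := fun z => by
      rw [hS]; exact Submodule.mem_top
    have hval : ∀ z (h : z ∈ (sqrtResolvent H).domain), sqrtResolvent H ⟨z, h⟩ = S z := by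
      rw [hS]; intro z h; rfl
    have h1 : ‖V u v‖ₑ ≤ formNorm H V := by
      unfold formNorm
      refine le_iSup_of_le ⟨x, hdom x⟩ <| le_iSup_of_le ⟨y, hdom y⟩ <| le_iSup_of_le hx <|
        le_iSup_of_le hy <| le_iSup_of_le u <| le_iSup_of_le v <|
        le_iSup_of_le (by rw [hval, hu]) <| le_iSup_of_le (by rw [hval, hv]) le_rfl
    have h2 := h1.trans_lt hV
    rw [← ofReal_norm] at h2
    exact (ENNReal.ofReal_lt_ofReal_iff'.1 h2).1.le
  have hz : ∀ z : E, ‖((‖z‖⁻¹ : ℝ) : ℂ) • z‖ ≤ 1 := fun z => by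
    rw [norm_smul, Complex.norm_real, norm_inv, norm_norm]
    exact inv_mul_le_one
  have hS0 : ∀ (u : formDomain H) (x : E), (u : E) = S x → ‖x‖ = 0 → u = 0 := by
    intro u x hu hx
    rw [norm_eq_zero.1 hx, map_zero] at hu
    exact Subtype.ext hu
  rcases eq_or_ne ‖x‖ 0 with hx | hx
  · rw [hS0 u x hu hx, hx]; simp
  rcases eq_or_ne ‖y‖ 0 with hy | hy
  · rw [hS0 v y hv hy, hy]; simp
  have h := hunit (((‖x‖⁻¹ : ℝ) : ℂ) • u) (((‖y‖⁻¹ : ℝ) : ℂ) • v) _ _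
    (by rw [map_smul, ← hu]; rfl) (by rw [map_smul, ← hv]; rfl) (hz x) (hz y)
  rw [LinearMap.map_smulₛₗ V, LinearMap.smul_apply, LinearMap.map_smul, norm_smul, norm_smul,
    Complex.conj_ofReal,
    Complex.norm_real, Complex.norm_real, norm_inv, norm_inv, norm_norm, norm_norm] at h
  field_simp at h
  linarith

/-- Form perturbations of a diagonal operator `H ≥ I` with `exp (-p H)` of trace class. -/
lemma IsDiag.exists_isDiag_perturbed {H : E →ₗ.[ℂ] E} {b : HilbertBasis ι ℂ E} {h : ι → ℝ}
    (hH : IsDiag H b h) (hh : ∀ i, 1 ≤ h i) {p : ℝ} (hp : 0 < p)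
    (hs : Summable fun i => Real.exp (-(p * h i))) {a : ℝ} (ha0 : 0 ≤ a) (ha : a < 1)
    {V : formDomain H →ₗ⋆[ℂ] formDomain H →ₗ[ℂ] ℂ} (hV : ∀ u v, V v u = conj (V u v))
    (hVa : formNorm H V < ENNReal.ofReal a) :
    ∃ (s : Set E) (f : HilbertBasis s ℂ E) (μ : s → ℝ), IsDiag (perturbed H V) f μ ∧
      (∀ n, 0 < μ n) ∧ ∀ β : ℝ, p ≤ β * (1 - a) → Summable fun n => Real.exp (-(β * μ n)) := by
  obtain ⟨S, hS, hSR, hQ, hsqrt⟩ := hH.exists_sqrtResolvent hh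
  have hpos : ∀ i, 0 < Real.sqrt (h i) := fun i => Real.sqrt_pos.2 (by linarith [hh i])
  have hSsa : IsSelfAdjoint S := hS.isSelfAdjoint
  have hSin : ∀ x y, ⟪x, S y⟫_ℂ = ⟪S x, y⟫_ℂ := fun x y => (hSsa.isSymmetric x y).symm
  have hSinj : ∀ x, S x = 0 → x = 0 := fun x hx => hilbertBasis_ext b fun i => by
    have := hS.inner_apply x i
    rw [hx, inner_zero_right] at this
    rw [inner_zero_right]
    exact (mul_eq_zero.1 this.symm).resolve_left
      (by exact_mod_cast (inv_pos.2 (hpos i)).ne')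
  have hhlim : Filter.Tendsto h Filter.cofinite Filter.atTop := by
    have h1 := Real.tendsto_exp_comp_nhds_zero.1 hs.tendsto_cofinite_zero
    exact (Filter.tendsto_const_mul_atTop_of_pos hp).1 (Filter.tendsto_neg_atBot_iff.1 h1)
  have hScomp : IsCompactOperator S := by
    refine hS.isCompactOperator ?_
    have : Filter.Tendsto (fun i => (Real.sqrt (h i))⁻¹) Filter.cofinite (nhds 0) :=
      (Real.tendsto_sqrt_atTop.comp hhlim).inv_tendsto_atTop
    have h2 := (Complex.continuous_ofReal.tendsto 0).comp this
    rwa [Complex.ofReal_zero] at h2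
  have hQm : ∀ x, S x ∈ formDomain H := fun x => (hQ _).2 ⟨x, rfl⟩
  -- Pulling `V` back along `S` gives a bounded form on all of `E`, represented by `B`.
  let J : E →ₗ[ℂ] formDomain H := (S : E →ₗ[ℂ] E).codRestrict (formDomain H) hQm
  let W : E →ₗ⋆[ℂ] E →ₗ[ℂ] ℂ := LinearMap.mk₂'ₛₗ (starRingEnd ℂ) (RingHom.id ℂ)
    (fun x y => V (J x) (J y)) (by simp) (by simp) (by simp) (by simp)
  obtain ⟨B, hBsa, hBa, hB⟩ := exists_isSelfAdjoint_of_form W (fun x y => hV (J x) (J y)) ha0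
    (fun x y => norm_apply_le_of_formNorm_lt hSR hVa (u := J x) (v := J y) rfl rfl)
  -- As `‖B‖ ≤ a < 1`, the Neumann series inverts `1 + B`.
  let U : (E →L[ℂ] E)ˣ := Units.oneSub (-B) (by rw [norm_neg]; exact hBa.trans_lt ha)
  have hU : (U : E →L[ℂ] E) = 1 + B := by
    rw [Units.val_oneSub, sub_neg_eq_add]
  set K : E →L[ℂ] E := 1 + B with hKdef
  set K' : E →L[ℂ] E := ((U⁻¹ : (E →L[ℂ] E)ˣ) : E →L[ℂ] E) with hK'def
  have hKK' : K * K' = 1 := by rw [← hU]; exact U.mul_inv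
  have hK'K : K' * K = 1 := by rw [← hU]; exact U.inv_mul
  have hKsa : IsSelfAdjoint K := (IsSelfAdjoint.one _).add hBsa
  have hK'sa : IsSelfAdjoint K' := by
    have h1 : star K' * K = 1 := by
      have := congrArg star hKK'
      rwa [star_mul, hKsa.star_eq, star_one] at this
    exact left_inv_eq_right_inv h1 hKK'
  have hRsa : IsSelfAdjoint (S * K' * S) := by
    rw [IsSelfAdjoint, star_mul, star_mul, hSsa.star_eq, hK'sa.star_eq, mul_assoc]
  have hRcomp : IsCompactOperator (S * K' * S : E →L[ℂ] E) := hScomp.clm_comp (S * K')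
  have hKpos : ∀ y, (1 - a) * ‖y‖ ^ 2 ≤ RCLike.re ⟪K y, y⟫_ℂ := fun y => by
    have h1 : ⟪K y, y⟫_ℂ = ⟪y, y⟫_ℂ + ⟪B y, y⟫_ℂ := by
      rw [hKdef, add_apply, one_apply_eq_self, inner_add_left]
    have h2 : ‖⟪B y, y⟫_ℂ‖ ≤ a * ‖y‖ ^ 2 := by
      refine (norm_inner_le_norm _ _).trans ?_
      have := B.le_of_opNorm_le hBa y
      nlinarith [norm_nonneg y]
    have h3 := neg_abs_le (RCLike.re ⟪B y, y⟫_ℂ)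
    have h4 := RCLike.abs_re_le_norm ⟪B y, y⟫_ℂ
    rw [h1, map_add, inner_self_eq_norm_sq (𝕜 := ℂ) y]
    linarith
  obtain ⟨s, f, r, hR⟩ := exists_hilbertBasis_isDiagonal hRcomp hRsa
  have hKy : ∀ n, K (K' (S (f n))) = S (f n) := fun n => by
    rw [← mul_apply_eq_comp, hKK', one_apply_eq_self]
  have hSy : ∀ n, S (K' (S (f n))) = (r n : ℂ) • f n := fun n => hR.apply_basis n
  -- Coercivity of `K` at `y = K' (S (f n))`: there `⟪K y, y⟫ = ⟪f n, S y⟫ = r n`.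
  have hle : ∀ n, (1 - a) * ‖K' (S (f n))‖ ^ 2 ≤ r n := fun n => by
    refine (hKpos _).trans (le_of_eq ?_)
    rw [hKy, ← hSin, ← hR.re_inner_basis n]
    rfl
  have hr : ∀ n, 0 < r n := fun n => by
    refine lt_of_lt_of_le (mul_pos (by linarith) (pow_pos (norm_pos_iff.2 fun h0 => ?_) 2)) (hle n)
    have := hKy n
    rw [h0, map_zero] at this
    exact f.orthonormal.ne_zero n (hSinj _ this.symm)
  refine ⟨s, f, fun n => (r n)⁻¹, ?_, fun n => inv_pos.2 (hr n), fun β hβ => ?_⟩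
  · refine formOperator_isDiag (q := hamForm H + V) hSsa hQ (fun u v x y hu hv => ?_) hKK' hK'K
      (fun n => (hr n).ne') hR
    have h1 : (hamForm H + V) u v = ⟪sqrtOp H u, sqrtOp H v⟫_ℂ + V u v := rfl
    have hu' : u = J x := Subtype.ext hu
    have hv' : v = J y := Subtype.ext hv
    rw [h1, hsqrt u x hu, hsqrt v y hv, hKdef, add_apply, one_apply_eq_self, inner_add_right,
      ← hB, hu', hv']
    rfl
  · have hsum := summable_mul_norm_sq_inner b f (fun i => (Real.exp_pos (-(p * h i))).le) hs
    refine Summable.of_nonneg_of_le (fun n => (Real.exp_pos _).le) (fun n => ?_) hsum.prod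
    -- Since `S (K' (S (f n))) = r n • f n`, this is `‖S⁻¹ f n‖²`, the value `q₀(f n, f n)`.
    let m : ℝ := ((r n)⁻¹ * ‖K' (S (f n))‖) ^ 2
    have hw1 : HasSum (fun i => ‖⟪b i, f n⟫_ℂ‖ ^ 2) 1 := by
      have := hasSum_norm_sq_inner b (f n)
      rwa [f.orthonormal.1, one_pow] at this
    have hm : HasSum (fun i => h i * ‖⟪b i, f n⟫_ℂ‖ ^ 2) m := by
      have h1 := (hasSum_norm_sq_inner b (K' (S (f n)))).mul_left ((r n)⁻¹ ^ 2)
      rw [← mul_pow] at h1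
      refine h1.congr_fun fun i => ?_
      have h2 := hS.inner_apply (K' (S (f n))) i
      rw [hSy, inner_smul_right] at h2
      have h3 : ((Real.sqrt (h i) * r n : ℝ) : ℂ) * ⟪b i, f n⟫_ℂ = ⟪b i, K' (S (f n))⟫_ℂ := by
        rw [Complex.ofReal_mul, mul_assoc, h2, Complex.ofReal_inv, mul_inv_cancel_left₀]
        exact_mod_cast (hpos i).ne'
      rw [← h3, norm_sq_ofReal_mul, mul_pow, Real.sq_sqrt (by linarith [hh i])]
      field_simp [(hr n).ne']
    refine le_trans ?_ (exp_neg_mul_le_tsum (fun i => sq_nonneg _) hw1 hm p (hsum.prod_factor n))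
    rw [Real.exp_le_exp, neg_le_neg_iff]
    -- The form bound `(1 - a) q₀ ≤ q_V` at the eigenvector `f n`.
    have h5 : (1 - a) * m ≤ (r n)⁻¹ := by
      have := mul_le_mul_of_nonneg_left (hle n) (sq_nonneg (r n)⁻¹)
      calc (1 - a) * m = (r n)⁻¹ ^ 2 * ((1 - a) * ‖K' (S (f n))‖ ^ 2) := by simp only [m]; ring
        _ ≤ (r n)⁻¹ ^ 2 * r n := this
        _ = (r n)⁻¹ := by field_simp [(hr n).ne']
    have hβ0 : 0 < β := by
      by_contra hcon
      nlinarith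
    calc p * m ≤ β * (1 - a) * m := mul_le_mul_of_nonneg_right hβ (sq_nonneg _)
      _ = β * ((1 - a) * m) := by ring
      _ ≤ β * (r n)⁻¹ := mul_le_mul_of_nonneg_left h5 hβ0.le

/-! ### Gibbs states of diagonal operators -/

lemma IsDiag.expNeg_eq {A : E →ₗ.[ℂ] E} {b : HilbertBasis ι ℂ E} {μ : ι → ℝ}
    (hA : IsDiag A b μ) (hμ : ∀ i, 0 < μ i) {t : ℝ} (ht : 0 < t) :
    ∃ T : E →L[ℂ] E, expNeg t A = ofBounded T ∧
      IsDiagonal T b fun i => ((Real.exp (-(t * μ i)) : ℝ) : ℂ) := by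
  obtain ⟨T, hT⟩ := exists_isDiagonal b (fun i => ((Real.exp (-(t * μ i)) : ℝ) : ℂ)) (C := 1)
    (fun i => by
      rw [Complex.norm_real, Real.norm_of_nonneg (Real.exp_pos _).le, Real.exp_le_one_iff]
      linarith [mul_pos ht (hμ i)])
  exact ⟨T, (hA.funCalc _).ext hT.isDiag_ofBounded, hT⟩

/-- The exponent `β` itself witnesses `C_<`: the `β`-th power of the state has eigenvalues `Z^{-β}
exp (-(β * μ i))`. Nonemptiness of `ι` gives `Z > 0`. -/
lemma IsDiag.gibbsState_mem_manifoldM [Nonempty ι] {A : E →ₗ.[ℂ] E} {b : HilbertBasis ι ℂ E}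
    {μ : ι → ℝ} (hA : IsDiag A b μ) (hμ : ∀ i, 0 < μ i) {β : ℝ} (hβ : 0 < β) (hβ1 : β < 1)
    (hs : Summable fun i => Real.exp (-(β * μ i))) : gibbsState A ∈ manifoldM E := by
  obtain ⟨T, hTe, hT⟩ := hA.expNeg_eq hμ one_pos
  have hs1 : Summable fun i => Real.exp (-(1 * μ i)) :=
    Summable.of_nonneg_of_le (fun i => (Real.exp_pos _).le) (fun i => by
      rw [Real.exp_le_exp, neg_le_neg_iff]
      exact mul_le_mul_of_nonneg_right hβ1.le (hμ i).le) hs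
  set Z : ℝ := ∑' i, Real.exp (-(1 * μ i)) with hZ
  have hZpos : 0 < Z := hs1.tsum_pos (fun i => (Real.exp_pos _).le)
    (Classical.arbitrary ι) (Real.exp_pos _)
  have htr : opTrace T = (Z : ℂ) := hT.opTrace_eq (fun i => (Real.exp_pos _).le) hs1
  have hρ : gibbsState A = (Z : ℂ)⁻¹ • T := by
    rw [gibbsState, hTe, toBounded_ofBounded, htr]
  have hpos : ∀ i, 0 < Z⁻¹ * Real.exp (-(1 * μ i)) := fun i =>
    mul_pos (inv_pos.2 hZpos) (Real.exp_pos _)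
  have hd : IsDiagonal (gibbsState A) b
      fun i => ((Z⁻¹ * Real.exp (-(1 * μ i)) : ℝ) : ℂ) := fun ψ i => by
    rw [hρ, smul_apply, inner_smul_right, hT]
    push_cast
    ring
  have hsρ : Summable fun i => Z⁻¹ * Real.exp (-(1 * μ i)) := hs1.mul_left _
  refine ⟨Set.mem_iUnion₂.2 ⟨β, ⟨hβ, hβ1⟩, ?_⟩, ⟨hd.isPositive fun i => (hpos i).le,
    hd.isTraceClass (fun i => (hpos i).le) hsρ, ?_⟩, ?_⟩
  · change IsTraceClass (CFC.abs (gibbsState A) ^ β)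
    rw [hd.abs_eq fun i => (hpos i).le]
    refine (hd.rpow (fun i => (hpos i).le) hβ.le).isTraceClass
      (fun i => Real.rpow_nonneg (hpos i).le _) ?_
    refine (hs.mul_left (Z⁻¹ ^ β)).congr fun i => ?_
    rw [Real.mul_rpow (inv_nonneg.2 hZpos.le) (Real.exp_pos _).le, ← Real.exp_mul]
    ring_nf
  · rw [hd.opTrace_eq (fun i => (hpos i).le) hsρ, tsum_mul_left, ← hZ,
      inv_mul_cancel₀ hZpos.ne', Complex.ofReal_one]
  · refine (injective_iff_map_eq_zero _).2 fun x hx => hilbertBasis_ext b fun i => ?_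
    have := hd.inner_apply x i
    rw [hx, inner_zero_right] at this
    rw [inner_zero_right]
    exact (mul_eq_zero.1 this.symm).resolve_left (by exact_mod_cast (hpos i).ne')

/-- The spectral decomposition of a state in `M`. -/
lemma exists_isDiagonal_of_mem_manifoldM {ρ : E →L[ℂ] E} (hρ : ρ ∈ manifoldM E) :
    ∃ (p : ℝ) (s : Set E) (b : HilbertBasis s ℂ E) (d : s → ℝ), 0 < p ∧ p < 1 ∧
      IsDiagonal ρ b (fun i => (d i : ℂ)) ∧ (∀ i, 0 < d i) ∧ Summable fun i => d i ^ p := by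
  obtain ⟨hC, ⟨hpos, htc, -⟩, hinj⟩ := hρ
  obtain ⟨p, ⟨hp0, hp1⟩, hp⟩ := Set.mem_iUnion₂.1 hC
  obtain ⟨s, b, d, hd⟩ :=
    exists_hilbertBasis_isDiagonal (htc.isCompactOperator hpos) hpos.isSelfAdjoint
  have hd0 : ∀ i, 0 < d i := fun i => by
    refine lt_of_le_of_ne ?_ fun h0 => ?_
    · rw [← hd.re_inner_basis i]
      exact hpos.re_inner_nonneg_right (b i)
    · have h1 := hd.apply_basis i
      rw [← h0, Complex.ofReal_zero, zero_smul, ← map_zero ρ] at h1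
      exact b.orthonormal.ne_zero i (hinj h1)
  refine ⟨p, s, b, d, hp0, hp1, hd, hd0, ?_⟩
  change IsTraceClass (CFC.abs ρ ^ p) at hp
  rw [hd.abs_eq fun i => (hd0 i).le] at hp
  exact (hd.rpow (fun i => (hd0 i).le) hp0.le).summable_of_isTraceClass
    (fun i => Real.rpow_nonneg (hd0 i).le _) hp

/-- On the zero space every trace vanishes. This ensures that the eigenbasis of the perturbed
operator is nonempty. -/
lemma nontrivial_of_mem_manifoldM {ρ : E →L[ℂ] E} (hρ : ρ ∈ manifoldM E) : Nontrivial E := by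
  by_contra hcon
  rw [not_nontrivial_iff_subsingleton] at hcon
  have h1 : opTrace ρ = 1 := hρ.2.1.2.2
  have h0 : opTrace ρ = 0 := by
    unfold opTrace
    simp [Subsingleton.elim _ (0 : E)]
  exact zero_ne_one (h0.symm.trans h1)

end QuantumInfo

open QuantumInfo

theorem mainTheorem2 {E : Type*} [NormedAddCommGroup E] [InnerProductSpace ℂ E]
    [CompleteSpace E] (ρ₀ : E →L[ℂ] E) (hρ₀ : ρ₀ ∈ manifoldM E)
    (c : ℝ) (hc : GeOne (hamiltonian ρ₀ c)) :
    ∃ ε : ℝ, 0 < ε ∧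
      ∀ V : formDomain (hamiltonian ρ₀ c) →ₗ⋆[ℂ] formDomain (hamiltonian ρ₀ c) →ₗ[ℂ] ℂ,
        (∀ u v, V v u = conj (V u v)) →
        formNorm (hamiltonian ρ₀ c) V < ENNReal.ofReal ε →
          IsSelfAdjoint (perturbed (hamiltonian ρ₀ c) V) ∧
          HasPurelyDiscreteSpectrum (perturbed (hamiltonian ρ₀ c) V) ∧
          (∃ β : ℝ, 0 < β ∧ β < 1 ∧
            IsTraceClassOp (expNeg β (perturbed (hamiltonian ρ₀ c) V))) ∧
          gibbsState (perturbed (hamiltonian ρ₀ c) V) ∈ manifoldM E := by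
  obtain ⟨p, s, b, d, hp0, hp1, hd, hd0, hds⟩ := exists_isDiagonal_of_mem_manifoldM hρ₀
  have hnt := nontrivial_of_mem_manifoldM hρ₀
  have hH : IsDiag (hamiltonian ρ₀ c) b fun i => -Real.log (d i) + c :=
    hd.isDiag_ofBounded.funCalc _
  have hh : ∀ i, 1 ≤ -Real.log (d i) + c := fun i => by
    have h1 := hc ⟨b i, hH.basis_mem i⟩
    rw [hH.inner_apply, b.orthonormal.1, inner_hilbertBasis_self, mul_one, one_pow] at h1
    exact h1
  -- Up to the factor `exp (-(p * c))`, this is the trace of `ρ₀ ^ p`.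
  have hs : Summable fun i => Real.exp (-(p * (-Real.log (d i) + c))) := by
    refine (hds.mul_left (Real.exp (-(p * c)))).congr fun i => ?_
    rw [Real.rpow_def_of_pos (hd0 i), ← Real.exp_add]
    ring_nf
  -- Any `ε` in `(0, 1 - p)` would do, since `β = p / (1 - ε)` must be below `1`. The midpoint gives
  -- `β = 2 * p / (1 + p)`.
  refine ⟨(1 - p) / 2, by linarith, fun V hV hVa => ?_⟩
  obtain ⟨t, f, μ, hA, hμ, hμs⟩ :=
    hH.exists_isDiag_perturbed hh hp0 hs (by linarith) (by linarith) hV hVa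
  have hβ0 : 0 < 2 * p / (1 + p) := by positivity
  have hβ1 : 2 * p / (1 + p) < 1 := by
    rw [div_lt_one (by linarith)]; linarith
  have hsβ := hμs (2 * p / (1 + p)) (le_of_eq (by field_simp; ring))
  have hμlim : Filter.Tendsto μ Filter.cofinite Filter.atTop := by
    have h1 := Real.tendsto_exp_comp_nhds_zero.1 hsβ.tendsto_cofinite_zero
    exact (Filter.tendsto_const_mul_atTop_of_pos hβ0).1 (Filter.tendsto_neg_atBot_iff.1 h1)
  have hne : Nonempty t := by
    by_contra hcon
    rw [not_nonempty_iff] at hcon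
    obtain ⟨x, y, hxy⟩ := hnt
    exact hxy (hilbertBasis_ext f fun i => hcon.elim i)
  obtain ⟨T, hTe, hT⟩ := hA.expNeg_eq hμ hβ0
  exact ⟨hA.isSelfAdjoint, hA.hasPurelyDiscreteSpectrum hμlim,
    ⟨_, hβ0, hβ1, T, hTe.symm, hT.isTraceClass (fun i => (Real.exp_pos _).le) hsβ⟩,
    hA.gibbsState_mem_manifoldM hμ hβ0 hβ1 hsβ⟩
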